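/- **Setting.** Let $3\le k\le\infty$ and let $f:[0,r_0)\to\mathbb R$ $(r_0>0)$ be of class $C^{k+1}$ (one-sided at $0$) with $f(0)=0$ and a vertical asymptote at $r_0$: $f(r)\to+\infty$ and $f'(r)\to+\infty$ as $r\to r_0^-$. Put $\mu=\arctan f'$. The sphere $S^3$ is the union of two solid tori $D^2\times S^1$, with polar coordinates $(r,\theta)$, $0\le r\le r_0$, on $D^2$ and angle $t$ on $S^1$, glued along their boundaries $r=r_0$ with meridians and parallels exchanged. On each solid torus put $$\omega=\pm(\cos\mu(r)\,dt-\sin\mu(r)\,dr),\qquad T=\pm(\cos\mu(r)\,\partial_t-\sin\mu(r)\,\partial_r),$$ with sign $+$ on one torus and $-$ on the other (so that the two sides agree on the common boundary). Then $\omega(T)=1$, and $\ker\omega$ is the Reeb foliation of $S^3$ produced by $f$; its singular set $\Sigma$ consists of the two core circles $r=0$. For a pair $(\omega,T)$ of a one-form and a vector field with $\omega(T)=1$ set $\eta=\iota_T\,d\omega$ and $\mathrm{gv}(\omega,T)=\int\eta\wedge d\eta$. **Variations.** A variation is a family $(\omega_s,T_s)$, $|s|<\varepsilon$, of one-forms ($\ker\omega_s$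 is not required to be integrable) and vector fields with $\omega_s(T_s)=1$ and $(\omega_0,T_0)=(\omega,T)$, of class $C^k$ jointly in $s$ and the point on the two open solid tori minus their cores, and with $(\omega_s,T_s)=(\omega,T)$ for $r\ge r_1$ with some $r_1<r_0$ (that is, near the torus separating the two components). A dot denotes the derivative at $s=0$. The variation is *admissible* if on $|s|<\varepsilon$ the $s$-derivative of $\eta_s\wedge d\eta_s$ is dominated by an integrable function, and for the metric $g=dr^2+r^2d\theta^2+dt^2$ and some $p\ge2$ $$\int\|\eta\wedge\dot\eta+2\,\dot\omega\wedge\iota_T\,d\eta\|^p\,dV_g<\infty .$$ It is *constrained* if $\int\omega_s\wedge d\omega_s=0$ for all $|s|<\varepsilon$, the $s$-derivative of $\omega_s\wedge d\omega_s$ is likewise dominated, and $\int\|\omega\wedge\dot\omega\|^p\,dV_g<\infty$ for some $p\ge 2$. The Reeb foliation is *critical* if $\frac{d}{ds}\big|_{s=0}\mathrm{gv}(\omega_s,T_s)=0$ for every admissible variation, and *critical under the constraint* $\int\omega\wedge d\omega=0$ if this holds for every admissible constrained variation. **Proposition.** (i) The Reeb foliation of $S^3$ produced by $f$ is critical if and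 only if, for some real $A_0,A_1,A_2$, the function $f$ solves on $[0,r_0)$ the Cauchy problem $$f'''=\frac{2((f')^2-1)}{(1+(f')^2)f'}(f'')^2+\frac{A_0(1+(f')^2)^{5/2}}{(f')^3},\qquad f(0)=0,\ f'(0)=A_1\ne0,\ f''(0)=A_2,$$ where a solution has $f'\neq0$ on all of $[0,r_0)$. (ii) If $f'(0)\neq0$, then the Reeb foliation of $S^3$ produced by $f$ is critical under the constraint $\int\omega\wedge d\omega=0$ if and only if, for some real $\lambda,A_1,A_2,A_3$, the function $f$ solves the Cauchy problem $$f^{(4)}=\frac{6(f')^2-7}{f'(1+(f')^2)}f'''f''-\frac{2(3(f')^4-9(f')^2+2)}{(1+(f')^2)^2(f')^2}(f'')^3+\lambda\frac{1+(f')^2}{(f')^2}f'',$$ $$f(0)=0,\ f'(0)=A_1\ne0,\ f''(0)=A_2,\ f'''(0)=A_3,$$ where the differential equation is imposed, with one and the same $\lambda$, at every point of $[0,r_0)$ at which $f'\ne0$. -/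

import Mathlib

open Set Filter Topology MeasureTheory

noncomputable section

namespace ReebGV

/-! Calculus of differential forms in the coordinates `(r, θ, t)`. -/

/-- The coordinate space `(r, θ, t)`. -/
abbrev Coord : Type := ℝ × ℝ × ℝ

/-- `∂_r`. -/
def er : Coord := (1, 0, 0)
/-- `∂_θ`. -/
def eθ : Coord := (0, 1, 0)
/-- `∂_t`. -/
def et : Coord := (0, 0, 1)

/-- The covector `a dr + b dθ + c dt`. -/
def covec (a b c : ℝ) : Coord →L[ℝ] ℝ :=
  a • ContinuousLinearMap.fst ℝ ℝ (ℝ × ℝ)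
    + b • (ContinuousLinearMap.fst ℝ ℝ ℝ).comp (ContinuousLinearMap.snd ℝ ℝ (ℝ × ℝ))
    + c • (ContinuousLinearMap.snd ℝ ℝ ℝ).comp (ContinuousLinearMap.snd ℝ ℝ (ℝ × ℝ))

theorem covec_apply (a b c : ℝ) (v : Coord) :
    covec a b c v = a * v.1 + b * v.2.1 + c * v.2.2 := by
  simp [covec]

/-- The exterior derivative of the one-form `α`. -/
def dForm (α : Coord → Coord →L[ℝ] ℝ) : Coord → Coord [⋀^Fin 2]→L[ℝ] ℝ :=
  extDeriv fun y => ContinuousAlternatingMap.ofSubsingletonLIE (𝕜 := ℝ) (E := Coord) (F := ℝ) (0 : Fin 1) (α y)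

theorem dForm_apply {α : Coord → Coord →L[ℝ] ℝ} {x : Coord} (h : DifferentiableAt ℝ α x)
    (u v : Coord) : dForm α x ![u, v] = fderiv ℝ α x u v - fderiv ℝ α x v u := by
  have hω : DifferentiableAt ℝ
      (fun y => ContinuousAlternatingMap.ofSubsingletonLIE (𝕜 := ℝ) (E := Coord) (F := ℝ) (0 : Fin 1) (α y)) x :=
    (ContinuousAlternatingMap.ofSubsingletonLIE (𝕜 := ℝ) (E := Coord) (F := ℝ) (0 : Fin 1)).toContinuousLinearEquiv.differentiableAt.comp x h
  rw [dForm, extDeriv_apply hω]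
  have h1 : ∀ w z : Coord, fderiv ℝ (fun y => α y w) x z = fderiv ℝ α x z w := fun w z => by
    rw [fderiv_clm_apply h (differentiableAt_const w)]
    simp
  rw [Fin.sum_univ_two]
  simp [Fin.removeNth_apply, h1, sub_eq_add_neg]

/-- The contraction `ι_v β` of a 2-covector `β` with a vector `v`. -/
def contract (v : Coord) (β : Coord [⋀^Fin 2]→L[ℝ] ℝ) : Coord →L[ℝ] ℝ :=
  (ContinuousAlternatingMap.ofSubsingletonLIE (𝕜 := ℝ) (E := Coord) (F := ℝ) (0 : Fin 1)).symm (β.curryLeft v)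

theorem contract_apply (v w : Coord) (β : Coord [⋀^Fin 2]→L[ℝ] ℝ) :
    contract v β w = β ![v, w] := by
  have h : (fun i : Fin 2 => (Matrix.vecCons v fun _ : Fin 1 => w) i) = ![v, w] := by
    ext i <;> fin_cases i <;> rfl
  simpa [contract] using congrArg β h

/-- The wedge product `α ∧ β` of two covectors, evaluated on `(u, v)`. -/
def wedge (α β : Coord →L[ℝ] ℝ) (u v : Coord) : ℝ := α u * β v - α v * β u

/-- The coefficient of `dr ∧ dθ ∧ dt` in `α ∧ β`, for a covector `α` and a 2-covector `β`. -/
def wedgeTop (α : Coord →L[ℝ] ℝ) (β : Coord [⋀^Fin 2]→L[ℝ] ℝ) : ℝ :=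
  α er * β ![eθ, et] + α eθ * β ![et, er] + α et * β ![er, eθ]

/-- The one-form `η = ι_T dω`. -/
def etaForm (ω : Coord → Coord →L[ℝ] ℝ) (T : Coord → Coord) (x : Coord) : Coord →L[ℝ] ℝ :=
  contract (T x) (dForm ω x)

/-- Norm of a 2-form at the point `x`, with respect to `g = dr² + r² dθ² + dt²`: the vectors
`∂_r`, `r⁻¹ ∂_θ`, `∂_t` are `g`-orthonormal. -/
def normTwo (x : Coord) (β : Coord → Coord → ℝ) : ℝ :=
  Real.sqrt (β er (x.1⁻¹ • eθ) ^ 2 + β er et ^ 2 + β (x.1⁻¹ • eθ) et ^ 2)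

/-! The sphere as a union of two solid tori. -/

/-- The sphere `S³ ⊂ ℂ²` is the union of two solid tori `D² × S¹`, `D² = {r ≤ r₀}`, glued along
their boundaries so that meridians and parallels are exchanged. The torus with index `c` is
parametrized by `reebMap r₀ c`, where `(r, θ)` are polar coordinates in `D²` and `t` is the angle
along `S¹`. The cores `r = 0` form the singular set. -/
def reebMap (r₀ : ℝ) (c : Bool) (x : Coord) : EuclideanSpace ℂ (Fin 2) :=
  let z : ℂ := (x.1 / Real.sqrt (x.1 ^ 2 + r₀ ^ 2) : ℝ) * Complex.exp (x.2.1 * Complex.I)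
  let w : ℂ := (r₀ / Real.sqrt (x.1 ^ 2 + r₀ ^ 2) : ℝ) * Complex.exp (x.2.2 * Complex.I)
  if c then !₂[z, w] else !₂[w, z]

theorem norm_reebMap {r₀ : ℝ} (h : 0 < r₀) (c : Bool) (x : Coord) : ‖reebMap r₀ c x‖ = 1 := by
  have h1 : 0 < x.1 ^ 2 + r₀ ^ 2 := by positivity
  have h2 : ‖reebMap r₀ c x‖ ^ 2 = 1 := by
    have e : (x.1 / Real.sqrt (x.1 ^ 2 + r₀ ^ 2)) ^ 2
        + (r₀ / Real.sqrt (x.1 ^ 2 + r₀ ^ 2)) ^ 2 = 1 := by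
      rw [div_pow, div_pow, Real.sq_sqrt h1.le, ← add_div, div_self h1.ne']
    cases c <;>
      simp only [reebMap, EuclideanSpace.norm_sq_eq, Fin.sum_univ_two] <;>
      simp only [if_true, if_false, Bool.false_eq_true, PiLp.toLp_apply, Matrix.cons_val_zero,
        Matrix.cons_val_one, norm_mul, Complex.norm_exp_ofReal_mul_I, mul_one, Complex.norm_real,
        Real.norm_eq_abs, sq_abs]
    · rw [add_comm, e]
    · exact e
  nlinarith [norm_nonneg (reebMap r₀ c x)]

theorem reebMap_glue (r₀ θ t : ℝ) :
    reebMap r₀ true (r₀, θ, t) = reebMap r₀ false (r₀, t, θ) := by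
  simp [reebMap]

theorem exists_reebMap_eq {r₀ : ℝ} (h : 0 < r₀) (y : EuclideanSpace ℂ (Fin 2)) (hy : ‖y‖ = 1) :
    ∃ c x, x.1 ∈ Icc 0 r₀ ∧ reebMap r₀ c x = y := by
  have key : ∀ a b : ℂ, ‖a‖ ^ 2 + ‖b‖ ^ 2 = 1 → ‖a‖ ≤ ‖b‖ →
      ∃ r ∈ Icc 0 r₀, (r / Real.sqrt (r ^ 2 + r₀ ^ 2) : ℝ) = ‖a‖ ∧
        (r₀ / Real.sqrt (r ^ 2 + r₀ ^ 2) : ℝ) = ‖b‖ := by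
    intro a b hab hle
    have hb : 0 < ‖b‖ := by
      rcases (norm_nonneg b).lt_or_eq with hb | hb
      · exact hb
      · nlinarith [norm_nonneg a]
    have hs : Real.sqrt ((r₀ * ‖a‖ / ‖b‖) ^ 2 + r₀ ^ 2) = r₀ / ‖b‖ := by
      rw [show (r₀ * ‖a‖ / ‖b‖) ^ 2 + r₀ ^ 2 = (r₀ / ‖b‖) ^ 2 by
        field_simp
        linarith]
      exact Real.sqrt_sq (by positivity)
    refine ⟨r₀ * ‖a‖ / ‖b‖, ⟨by positivity, ?_⟩, ?_, ?_⟩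
    · rw [div_le_iff₀ hb]
      exact mul_le_mul_of_nonneg_left hle h.le
    · rw [hs]
      field_simp
    · rw [hs]
      field_simp
  have hy2 : ‖y 0‖ ^ 2 + ‖y 1‖ ^ 2 = 1 := by
    have h2 := EuclideanSpace.norm_sq_eq y
    rw [hy, Fin.sum_univ_two] at h2
    linarith
  rcases le_total ‖y 0‖ ‖y 1‖ with hle | hle
  · obtain ⟨r, hr, h1, h2⟩ := key _ _ hy2 hle
    refine ⟨true, (r, (y 0).arg, (y 1).arg), hr, ?_⟩
    ext i
    fin_cases i <;> simp [reebMap, h1, h2, -Complex.ofReal_div]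
  · obtain ⟨r, hr, h1, h2⟩ := key _ _ (by linarith) hle
    refine ⟨false, (r, (y 1).arg, (y 0).arg), hr, ?_⟩
    ext i
    fin_cases i <;> simp [reebMap, h1, h2, -Complex.ofReal_div]

/-- Coordinates of the open solid torus without its core. -/
def region (r₀ : ℝ) : Set Coord := {x | x.1 ∈ Ioo 0 r₀}

/-- A fundamental domain of the open solid torus without its core. -/
def cell (r₀ : ℝ) : Set Coord :=
  Ioo 0 r₀ ×ˢ Ioc 0 (2 * Real.pi) ×ˢ Ioc 0 (2 * Real.pi)

/-! The Reeb pair `(ω, T)`. -/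

/-- `μ(r) = arctan f'(r)` (one-sided derivative at `0`). -/
def reebAngle (r₀ : ℝ) (f : ℝ → ℝ) (r : ℝ) : ℝ :=
  Real.arctan (derivWithin f (Ico 0 r₀) r)

/-- The transverse orientations of the two Reeb components are opposite in the coordinates
`(r, θ, t)`, so that the two forms agree on the common boundary torus. -/
def reebSign (c : Bool) : ℝ := if c then 1 else -1

/-- `ω = ± (cos μ dt - sin μ dr)`. -/
def reebForm (r₀ : ℝ) (f : ℝ → ℝ) (c : Bool) (x : Coord) : Coord →L[ℝ] ℝ :=
  reebSign c •
    covec (-Real.sin (reebAngle r₀ f x.1)) 0 (Real.cos (reebAngle r₀ f x.1))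

/-- `T = ± (cos μ ∂_t - sin μ ∂_r)`. -/
def reebField (r₀ : ℝ) (f : ℝ → ℝ) (c : Bool) (x : Coord) : Coord :=
  reebSign c •
    (Real.cos (reebAngle r₀ f x.1) • et - Real.sin (reebAngle r₀ f x.1) • er)

theorem reebForm_reebField (r₀ : ℝ) (f : ℝ → ℝ) (c : Bool) (x : Coord) :
    reebForm r₀ f c x (reebField r₀ f c x) = 1 := by
  have h := Real.sin_sq_add_cos_sq (reebAngle r₀ f x.1)
  cases c <;> simp [reebForm, reebField, reebSign, covec_apply, er, et] <;> linarith

/-! Variations. -/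

/-- A `C^k` variation `(ω_s, T_s)`, `|s| < ε`, of the Reeb pair on `S³` minus the two cores, with
`ω_s(T_s) = 1`, constant in `s` near the torus which separates the two Reeb components. It is given
by its pullbacks under `reebMap r₀ c` (coefficients of forms and fields on the sphere depend only on
the point of the sphere). The distributions `ker ω_s` need not be integrable. -/
structure Variation (k : ℕ∞) (r₀ : ℝ) (f : ℝ → ℝ) where
  ε : ℝ
  ε_pos : 0 < ε
  ω : Bool → ℝ → Coord → Coord →L[ℝ] ℝ
  T : Bool → ℝ → Coord → Coord
  contDiffOn_ω : ∀ c, ContDiffOn ℝ k (fun y : ℝ × Coord => ω c y.1 y.2)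
    (Ioo (-ε) ε ×ˢ region r₀)
  contDiffOn_T : ∀ c, ContDiffOn ℝ k (fun y : ℝ × Coord => T c y.1 y.2)
    (Ioo (-ε) ε ×ˢ region r₀)
  ω_zero : ∀ c, ∀ x ∈ region r₀, ω c 0 x = reebForm r₀ f c x
  T_zero : ∀ c, ∀ x ∈ region r₀, T c 0 x = reebField r₀ f c x
  normalized : ∀ c, ∀ s ∈ Ioo (-ε) ε, ∀ x ∈ region r₀, ω c s x (T c s x) = 1
  ω_descends : ∀ c, ∀ s ∈ Ioo (-ε) ε, ∀ x ∈ region r₀, ∀ y ∈ region r₀,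
    reebMap r₀ c x = reebMap r₀ c y → ω c s x = ω c s y
  T_descends : ∀ c, ∀ s ∈ Ioo (-ε) ε, ∀ x ∈ region r₀, ∀ y ∈ region r₀,
    reebMap r₀ c x = reebMap r₀ c y → T c s x = T c s y
  constant_near_torus : ∃ r₁ < r₀, ∀ c, ∀ s ∈ Ioo (-ε) ε, ∀ x ∈ region r₀, r₁ ≤ x.1 →
    ω c s x = reebForm r₀ f c x ∧ T c s x = reebField r₀ f c x

namespace Variation

variable {k : ℕ∞} {r₀ : ℝ} {f : ℝ → ℝ} (V : Variation k r₀ f)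

/-- `η_s = ι_{T_s} dω_s`. -/
def η (c : Bool) (s : ℝ) (x : Coord) : Coord →L[ℝ] ℝ := etaForm (V.ω c s) (V.T c s) x

/-- `η_s ∧ dη_s`. -/
def gvDensity (c : Bool) (s : ℝ) (x : Coord) : ℝ :=
  wedgeTop (V.η c s x) (dForm (V.η c s) x)

/-- `ω_s ∧ dω_s`. -/
def intDensity (c : Bool) (s : ℝ) (x : Coord) : ℝ :=
  wedgeTop (V.ω c s x) (dForm (V.ω c s) x)

/-- `gv(ω_s, T_s) = ∫ η_s ∧ dη_s`. -/
def gv (s : ℝ) : ℝ := ∑ c, ∫ x in cell r₀, V.gvDensity c s x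

/-- `∫ ω_s ∧ dω_s`. -/
def intAverage (s : ℝ) : ℝ := ∑ c, ∫ x in cell r₀, V.intDensity c s x

/-- `ω̇`, the derivative of `ω_s` at `s = 0`. -/
def ωDot (c : Bool) (x : Coord) : Coord →L[ℝ] ℝ := deriv (fun s => V.ω c s x) 0

/-- `η̇`, the derivative of `η_s` at `s = 0`. -/
def ηDot (c : Bool) (x : Coord) : Coord →L[ℝ] ℝ := deriv (fun s => V.η c s x) 0

/-- The 2-form `η ∧ η̇ + 2 ω̇ ∧ ι_T dη`. -/
def gvBoundary (c : Bool) (x u v : Coord) : ℝ :=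
  wedge (V.η c 0 x) (V.ηDot c x) u v
    + 2 * wedge (V.ωDot c x) (contract (V.T c 0 x) (dForm (V.η c 0) x)) u v

/-- The 2-form `ω ∧ ω̇`. -/
def intBoundary (c : Bool) (x u v : Coord) : ℝ := wedge (V.ω c 0 x) (V.ωDot c x) u v

/-- The `s`-derivatives of the densities `q c s` are dominated on `|s| < ε` by an integrable
function, so that `∫ q` may be differentiated under the integral sign. -/
def Dominated (q : Bool → ℝ → Coord → ℝ) : Prop :=
  ∀ c, ∃ b : Coord → ℝ, IntegrableOn b (cell r₀) ∧
    ∀ s ∈ Ioo (-V.ε) V.ε, ∀ x ∈ cell r₀, |deriv (fun σ => q c σ x) s| ≤ b x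

/-- Variations for which `gv` can be differentiated under the integral and
`∫ ‖η ∧ η̇ + 2 ω̇ ∧ ι_T dη‖^p dV < ∞` for some `p ≥ 2`. -/
def Admissible : Prop :=
  V.Dominated V.gvDensity ∧
    ∃ p : ℝ, 2 ≤ p ∧ ∀ c,
      IntegrableOn (fun x => normTwo x (V.gvBoundary c x) ^ p * x.1) (cell r₀)

/-- Variations with `∫ ω_s ∧ dω_s = 0` for all `s`, for which this integral can be differentiated
under the integral sign and `∫ ‖ω ∧ ω̇‖^p dV < ∞` for some `p ≥ 2`. -/
def Constrained : Prop :=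
  (∀ s ∈ Ioo (-V.ε) V.ε, V.intAverage s = 0) ∧ V.Dominated V.intDensity ∧
    ∃ p : ℝ, 2 ≤ p ∧ ∀ c,
      IntegrableOn (fun x => normTwo x (V.intBoundary c x) ^ p * x.1) (cell r₀)

end Variation

/-- The Reeb pair is critical for `gv` with respect to all admissible variations. -/
def IsCritical (k : ℕ∞) (r₀ : ℝ) (f : ℝ → ℝ) : Prop :=
  ∀ V : Variation k r₀ f, V.Admissible → HasDerivAt V.gv 0 0

/-- The Reeb pair is critical for `gv` with respect to all admissible variations that satisfy the
constraint `∫ ω_s ∧ dω_s = 0`. -/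
def IsConstrainedCritical (k : ℕ∞) (r₀ : ℝ) (f : ℝ → ℝ) : Prop :=
  ∀ V : Variation k r₀ f, V.Admissible → V.Constrained → HasDerivAt V.gv 0 0

/-! The Cauchy problems. -/

/-- The `j`-th derivative of `f` on `[0, r₀)`, one-sided at `0`. -/
def der (r₀ : ℝ) (f : ℝ → ℝ) (j : ℕ) (r : ℝ) : ℝ := iteratedDerivWithin j f (Ico 0 r₀) r

/-- `f` solves, on `[0, r₀)`, the third order Cauchy problem with parameters `A₀`, `A₁`, `A₂`. -/
def SolvesThirdOrder (r₀ : ℝ) (f : ℝ → ℝ) (A₀ A₁ A₂ : ℝ) : Prop :=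
  (∀ r ∈ Ico 0 r₀, der r₀ f 1 r ≠ 0 ∧
    der r₀ f 3 r =
      2 * (der r₀ f 1 r ^ 2 - 1) / ((1 + der r₀ f 1 r ^ 2) * der r₀ f 1 r) * der r₀ f 2 r ^ 2
        + A₀ * (1 + der r₀ f 1 r ^ 2) ^ (5 / 2 : ℝ) / der r₀ f 1 r ^ 3) ∧
  f 0 = 0 ∧ der r₀ f 1 0 = A₁ ∧ A₁ ≠ 0 ∧ der r₀ f 2 0 = A₂

/-- `f` solves the fourth order Cauchy problem with parameters `lam`, `A₁`, `A₂`, `A₃`; the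
equation is imposed at every point of `[0, r₀)` where its right-hand side is defined (`f' ≠ 0`). -/
def SolvesFourthOrder (r₀ : ℝ) (f : ℝ → ℝ) (lam A₁ A₂ A₃ : ℝ) : Prop :=
  (∀ r ∈ Ico 0 r₀, der r₀ f 1 r ≠ 0 →
    der r₀ f 4 r =
      (6 * der r₀ f 1 r ^ 2 - 7) / (der r₀ f 1 r * (1 + der r₀ f 1 r ^ 2))
          * der r₀ f 3 r * der r₀ f 2 r
        - 2 * (3 * der r₀ f 1 r ^ 4 - 9 * der r₀ f 1 r ^ 2 + 2)
            / ((1 + der r₀ f 1 r ^ 2) ^ 2 * der r₀ f 1 r ^ 2) * der r₀ f 2 r ^ 3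
        + lam * ((1 + der r₀ f 1 r ^ 2) / der r₀ f 1 r ^ 2) * der r₀ f 2 r) ∧
  f 0 = 0 ∧ der r₀ f 1 0 = A₁ ∧ A₁ ≠ 0 ∧ der r₀ f 2 0 = A₂ ∧ der r₀ f 3 0 = A₃

end ReebGV

end

/-!
The theorem reduces a variational problem on `S³` to an Euler–Lagrange equation in the radial
variable.

*First variation.* In dimension three, for every family `(ω_s, T_s)`,
`d/ds (η ∧ dη) = 2 ι_Ṫ dω ∧ dη - 2 ω̇ ∧ d(ι_T dη) - d(η ∧ η̇ + 2 ω̇ ∧ ι_T dη)` and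
`d/ds (ω ∧ dω) = 2 ω̇ ∧ dω - d(ω ∧ ω̇)` (`hasDerivAt_gvDensity`, `hasDerivAt_intDensity`). At the
Reeb pair all of `dω`, `dη`, `d(ι_T dη)` are multiples of `dr ∧ dt`: with `h = μ' sin² μ`,
`dω = ∓ μ' sin μ dr ∧ dt`, `dη = h' dr ∧ dt` and `d(ι_T dη) = ∓ (h' sin μ)' dr ∧ dt`. Only the
coefficient `ω̇(∂_θ)` is left, and the Euler–Lagrange expressions are `(h' sin μ)'` for `gv`
(`gvEuler`) and `μ' sin μ` for the constraint (`intEuler`).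

*Exact terms.* By Stokes' theorem the integral of an exact term over `r > ρ` is the flux of a
two-form through the tube `r = ρ`. The flux has a limit as `ρ → 0`. If this limit were not zero, the
`L^p` condition with `p ≥ 2` would make `1 / r` integrable at `0`
(`setIntegral_divTwo_eq_zero`). So the exact terms contribute nothing, and `gv` is critical as soon
as `(h' sin μ)' = 0`; under the constraint it suffices that `(h' sin μ)' = λ μ' sin μ`.

*Necessity.* The variations `ω_s = ω + s φ(r) dθ`, `T_s = T`, with `φ` a bump function, have densities
linear in `s`, and they satisfy the constraint exactly when `∫ φ μ' sin μ dr = 0`. The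
fundamental lemma of the calculus of variations and the existence of a Lagrange multiplier
(`exists_multiplier`) give the converse statements (`isCritical_iff`,
`isConstrainedCritical_iff`).

*Ordinary differential equations.* Written in terms of `f`, the third order equation says that
`h' sin μ` is the constant `A₀`, the fourth order equation that `(h' sin μ)' = λ μ' sin μ` where
`f' ≠ 0`. Where `f' = 0` both sides of the latter vanish. That `f'` has no zero in the
unconstrained case follows from `f' → ∞` (`der_one_ne_zero`).
-/

noncomputable section

namespace ReebGV

/-! ### Forms in components -/

/-- The skew bilinear form `A(u, v) - A(v, u)`. Applied to the derivative of a one-form, it is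
the exterior derivative. -/
def skew (A : Coord →L[ℝ] Coord →L[ℝ] ℝ) : Coord →L[ℝ] Coord →L[ℝ] ℝ := A - A.flip

theorem skew_apply (A : Coord →L[ℝ] Coord →L[ℝ] ℝ) (u v : Coord) :
    skew A u v = A u v - A v u := rfl

/-- The coefficient of `dr ∧ dθ ∧ dt` in `α ∧ C`, where the bilinear form `C` stands for a
two-form. -/
def wedgeBilin (α : Coord →L[ℝ] ℝ) (C : Coord →L[ℝ] Coord →L[ℝ] ℝ) : ℝ :=
  α er * C eθ et + α eθ * C et er + α et * C er eθ

theorem contract_dForm {α : Coord → Coord →L[ℝ] ℝ} {x : Coord} (h : DifferentiableAt ℝ α x)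
    (v : Coord) : contract v (dForm α x) = skew (fderiv ℝ α x) v := by
  refine ContinuousLinearMap.ext fun w => ?_
  rw [contract_apply, dForm_apply h, skew_apply]

theorem wedgeTop_dForm {α : Coord → Coord →L[ℝ] ℝ} {x : Coord} (h : DifferentiableAt ℝ α x)
    (β : Coord →L[ℝ] ℝ) : wedgeTop β (dForm α x) = wedgeBilin β (skew (fderiv ℝ α x)) := by
  simp only [wedgeTop, wedgeBilin, dForm_apply h, skew_apply]

theorem coord_eq (v : Coord) : v = v.1 • er + v.2.1 • eθ + v.2.2 • et := by
  ext <;> simp [er, eθ, et]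

/-- The four-form `A ∧ B` vanishes in dimension three, hence so does its contraction with `v`. -/
theorem wedgeBilin_contract_antisymm (A B : Coord →L[ℝ] Coord →L[ℝ] ℝ) (v : Coord) :
    wedgeBilin (skew A v) (skew B) = -wedgeBilin (skew B v) (skew A) := by
  rw [coord_eq v]
  simp only [wedgeBilin, map_add, map_smul, add_apply,
    smul_apply, skew_apply, smul_eq_mul]
  ring

/-- The coefficient of `dr ∧ dθ ∧ dt` in the exterior derivative of the two-form `β`. -/
def divTwo (β : Coord → Coord → Coord → ℝ) (x : Coord) : ℝ :=
  fderiv ℝ (fun y => β y eθ et) x er + fderiv ℝ (fun y => β y et er) x eθ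
    + fderiv ℝ (fun y => β y er eθ) x et

theorem fderiv_wedge_apply {α β : Coord → Coord →L[ℝ] ℝ} {x : Coord}
    (hα : DifferentiableAt ℝ α x) (hβ : DifferentiableAt ℝ β x) (u v w : Coord) :
    fderiv ℝ (fun y => wedge (α y) (β y) u v) x w =
      fderiv ℝ α x w u * β x v + α x u * fderiv ℝ β x w v
        - (fderiv ℝ α x w v * β x u + α x v * fderiv ℝ β x w u) := by
  have h1 : ∀ {γ : Coord → Coord →L[ℝ] ℝ}, DifferentiableAt ℝ γ x → ∀ z,
      HasFDerivAt (fun y => γ y z) ((ContinuousLinearMap.apply ℝ ℝ z).comp (fderiv ℝ γ x)) x :=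
    fun hγ z => ((ContinuousLinearMap.apply ℝ ℝ z).hasFDerivAt).comp x hγ.hasFDerivAt
  have := (((h1 hα u).mul (h1 hβ v)).sub ((h1 hα v).mul (h1 hβ u))).fderiv
  unfold wedge
  rw [show (fun y => (α y) u * (β y) v - (α y) v * (β y) u) =
    ((fun y => α y u) * (fun y => β y v) - (fun y => α y v) * fun y => β y u) from rfl, this]
  simp
  ring

/-- `d(α ∧ β) = β ∧ dα - α ∧ dβ`. -/
theorem divTwo_wedge {α β : Coord → Coord →L[ℝ] ℝ} {x : Coord}
    (hα : DifferentiableAt ℝ α x) (hβ : DifferentiableAt ℝ β x) :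
    divTwo (fun y => wedge (α y) (β y)) x =
      wedgeBilin (β x) (skew (fderiv ℝ α x)) - wedgeBilin (α x) (skew (fderiv ℝ β x)) := by
  simp only [divTwo, fderiv_wedge_apply hα hβ, wedgeBilin, skew_apply]
  ring

theorem differentiableAt_wedge {α β : Coord → Coord →L[ℝ] ℝ} {x : Coord}
    (hα : DifferentiableAt ℝ α x) (hβ : DifferentiableAt ℝ β x) (u v : Coord) :
    DifferentiableAt ℝ (fun y => wedge (α y) (β y) u v) x := by
  unfold wedge
  fun_prop

theorem divTwo_add_mul {β γ : Coord → Coord → Coord → ℝ} {x : Coord} (c : ℝ)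
    (hβ : ∀ u v, DifferentiableAt ℝ (fun y => β y u v) x)
    (hγ : ∀ u v, DifferentiableAt ℝ (fun y => γ y u v) x) :
    divTwo (fun y u v => β y u v + c * γ y u v) x = divTwo β x + c * divTwo γ x := by
  have h : ∀ u v, fderiv ℝ (fun y => β y u v + c * γ y u v) x =
      fderiv ℝ (fun y => β y u v) x + c • fderiv ℝ (fun y => γ y u v) x := fun u v =>
    ((hβ u v).hasFDerivAt.add ((hγ u v).hasFDerivAt.const_smul c)).fderiv
  simp only [divTwo, h, add_apply, smul_apply, smul_eq_mul]
  ring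

/-! ### Joint regularity in the parameter and the point -/

section Joint

variable {F : Type*} [NormedAddCommGroup F] [NormedSpace ℝ F] {G : ℝ → Coord → F}
  {I : Set ℝ} {R : Set Coord} {s : ℝ} {x : Coord}

theorem hasFDerivAt_slice (h : DifferentiableAt ℝ (fun y : ℝ × Coord => G y.1 y.2) (s, x)) :
    HasFDerivAt (G s) ((fderiv ℝ (fun y : ℝ × Coord => G y.1 y.2) (s, x)).comp
      (ContinuousLinearMap.inr ℝ ℝ Coord)) x := by
  have h2 : HasFDerivAt (fun z : Coord => (s, z)) (ContinuousLinearMap.inr ℝ ℝ Coord) x :=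
    hasFDerivAt_prodMk_right s x
  exact HasFDerivAt.comp x (g := fun y : ℝ × Coord => G y.1 y.2) h.hasFDerivAt h2

theorem hasDerivAt_slice (h : DifferentiableAt ℝ (fun y : ℝ × Coord => G y.1 y.2) (s, x)) :
    HasDerivAt (fun σ => G σ x) (fderiv ℝ (fun y : ℝ × Coord => G y.1 y.2) (s, x) (1, 0)) s := by
  have h2 : HasDerivAt (fun σ : ℝ => (σ, x)) ((1 : ℝ), (0 : Coord)) s :=
    (hasDerivAt_id s).prodMk (hasDerivAt_const s x)
  exact HasFDerivAt.comp_hasDerivAt s (l := fun y : ℝ × Coord => G y.1 y.2) h.hasFDerivAt h2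

theorem differentiableAt_joint {n : WithTop ℕ∞} (hI : IsOpen I) (hR : IsOpen R)
    (hG : ContDiffOn ℝ n (fun y : ℝ × Coord => G y.1 y.2) (I ×ˢ R)) (hn : 1 ≤ n)
    (hs : s ∈ I) (hx : x ∈ R) :
    DifferentiableAt ℝ (fun y : ℝ × Coord => G y.1 y.2) (s, x) :=
  (hG.contDiffAt ((hI.prod hR).mem_nhds ⟨hs, hx⟩)).differentiableAt (by positivity)

theorem contDiffOn_slice {n : WithTop ℕ∞}
    (hG : ContDiffOn ℝ n (fun y : ℝ × Coord => G y.1 y.2) (I ×ˢ R)) (hs : s ∈ I) :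
    ContDiffOn ℝ n (G s) R :=
  hG.comp (f := fun z : Coord => (s, z)) (by fun_prop) fun _ hz => ⟨hs, hz⟩

theorem contDiffOn_fderiv_slice {m n : WithTop ℕ∞} (hI : IsOpen I) (hR : IsOpen R)
    (hG : ContDiffOn ℝ n (fun y : ℝ × Coord => G y.1 y.2) (I ×ˢ R)) (hmn : m + 1 ≤ n) :
    ContDiffOn ℝ m (fun y : ℝ × Coord => fderiv ℝ (G y.1) y.2) (I ×ˢ R) := by
  have h1 : ContDiffOn ℝ m (fun y : ℝ × Coord =>
      (fderiv ℝ (fun y : ℝ × Coord => G y.1 y.2) y).comp (ContinuousLinearMap.inr ℝ ℝ Coord))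
      (I ×ˢ R) :=
    (hG.fderiv_of_isOpen (hI.prod hR) hmn).clm_comp contDiffOn_const
  refine h1.congr fun y hy => ?_
  exact (hasFDerivAt_slice
    (differentiableAt_joint hI hR hG (le_trans le_add_self hmn) hy.1 hy.2)).fderiv

theorem contDiffOn_deriv_slice {m n : WithTop ℕ∞} (hI : IsOpen I) (hR : IsOpen R)
    (hG : ContDiffOn ℝ n (fun y : ℝ × Coord => G y.1 y.2) (I ×ˢ R)) (hmn : m + 1 ≤ n) :
    ContDiffOn ℝ m (fun y : ℝ × Coord => deriv (fun σ => G σ y.2) y.1) (I ×ˢ R) := by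
  have h1 : ContDiffOn ℝ m (fun y : ℝ × Coord =>
      fderiv ℝ (fun y : ℝ × Coord => G y.1 y.2) y (1, 0)) (I ×ˢ R) :=
    (hG.fderiv_of_isOpen (hI.prod hR) hmn).clm_apply contDiffOn_const
  refine h1.congr fun y hy => ?_
  exact (hasDerivAt_slice
    (differentiableAt_joint hI hR hG (le_trans le_add_self hmn) hy.1 hy.2)).deriv

/-- The derivatives in the parameter and in the point commute. -/
theorem hasDerivAt_fderiv_slice {n : WithTop ℕ∞} (hI : IsOpen I) (hR : IsOpen R)
    (hG : ContDiffOn ℝ n (fun y : ℝ × Coord => G y.1 y.2) (I ×ˢ R)) (hn : 2 ≤ n)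
    (hs : s ∈ I) (hx : x ∈ R) :
    HasDerivAt (fun σ => fderiv ℝ (G σ) x)
      (fderiv ℝ (fun y => deriv (fun σ => G σ y) s) x) s := by
  have h12 : (1 : WithTop ℕ∞) + 1 ≤ n := by rwa [one_add_one_eq_two]
  have h1n : (1 : WithTop ℕ∞) ≤ n := le_trans (by norm_num) hn
  have hU := (hI.prod hR).mem_nhds (show (s, x) ∈ I ×ˢ R from ⟨hs, hx⟩)
  have hsymm : IsSymmSndFDerivAt ℝ (fun y : ℝ × Coord => G y.1 y.2) (s, x) :=
    (hG.contDiffAt hU).isSymmSndFDerivAt (by simpa using hn)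
  have hD : DifferentiableAt ℝ (fderiv ℝ (fun y : ℝ × Coord => G y.1 y.2)) (s, x) :=
    ((hG.fderiv_of_isOpen (hI.prod hR) h12).contDiffAt hU).differentiableAt one_ne_zero
  have e1 : HasDerivAt (fun σ : ℝ => (σ, x)) ((1 : ℝ), (0 : Coord)) s :=
    (hasDerivAt_id s).prodMk (hasDerivAt_const s x)
  have e2 : HasFDerivAt (fun z : Coord => (s, z)) (ContinuousLinearMap.inr ℝ ℝ Coord) x :=
    hasFDerivAt_prodMk_right s x
  -- the parameter derivative of the space derivative
  have k1 : HasDerivAt (fun σ => (fderiv ℝ (fun y : ℝ × Coord => G y.1 y.2) (σ, x)).comp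
      (ContinuousLinearMap.inr ℝ ℝ Coord))
      ((fderiv ℝ (fderiv ℝ (fun y : ℝ × Coord => G y.1 y.2)) (s, x) (1, 0)).comp
        (ContinuousLinearMap.inr ℝ ℝ Coord)) s := by
    have h := hD.hasFDerivAt.comp_hasDerivAt s e1
    exact (ContinuousLinearMap.precomp F (ContinuousLinearMap.inr ℝ ℝ Coord)).hasFDerivAt.comp_hasDerivAt
      s h
  have k2 : HasDerivAt (fun σ => fderiv ℝ (G σ) x)
      ((fderiv ℝ (fderiv ℝ (fun y : ℝ × Coord => G y.1 y.2)) (s, x) (1, 0)).comp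
        (ContinuousLinearMap.inr ℝ ℝ Coord)) s := by
    refine k1.congr_of_eventuallyEq ?_
    filter_upwards [hI.mem_nhds hs] with σ hσ
    exact (hasFDerivAt_slice (differentiableAt_joint hI hR hG h1n hσ hx)).fderiv
  -- the space derivative of the parameter derivative
  have k3 : HasFDerivAt (fun z => fderiv ℝ (fun y : ℝ × Coord => G y.1 y.2) (s, z) (1, 0))
      ((ContinuousLinearMap.apply ℝ F ((1 : ℝ), (0 : Coord))).comp
        ((fderiv ℝ (fderiv ℝ (fun y : ℝ × Coord => G y.1 y.2)) (s, x)).comp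
          (ContinuousLinearMap.inr ℝ ℝ Coord))) x :=
    (ContinuousLinearMap.apply ℝ F ((1 : ℝ), (0 : Coord))).hasFDerivAt.comp x
      (hD.hasFDerivAt.comp x e2)
  have k4 : HasFDerivAt (fun y => deriv (fun σ => G σ y) s)
      ((ContinuousLinearMap.apply ℝ F ((1 : ℝ), (0 : Coord))).comp
        ((fderiv ℝ (fderiv ℝ (fun y : ℝ × Coord => G y.1 y.2)) (s, x)).comp
          (ContinuousLinearMap.inr ℝ ℝ Coord))) x := by
    refine k3.congr_of_eventuallyEq ?_
    filter_upwards [hR.mem_nhds hx] with z hz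
    exact (hasDerivAt_slice (differentiableAt_joint hI hR hG h1n hs hz)).deriv
  rw [k4.fderiv]
  convert k2 using 1
  refine ContinuousLinearMap.ext fun v => ?_
  exact hsymm _ _

end Joint
theorem hasDerivAt_wedgeBilin {α : ℝ → Coord →L[ℝ] ℝ} {C : ℝ → Coord →L[ℝ] Coord →L[ℝ] ℝ}
    {α' : Coord →L[ℝ] ℝ} {C' : Coord →L[ℝ] Coord →L[ℝ] ℝ} {s : ℝ} (hα : HasDerivAt α α' s)
    (hC : HasDerivAt C C' s) :
    HasDerivAt (fun σ => wedgeBilin (α σ) (C σ))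
      (wedgeBilin α' (C s) + wedgeBilin (α s) C') s := by
  have h1 : ∀ u, HasDerivAt (fun σ => α σ u) (α' u) s := fun u => by
    simpa using hα.clm_apply (hasDerivAt_const s u)
  have h2 : ∀ u v, HasDerivAt (fun σ => C σ u v) (C' u v) s := fun u v => by
    simpa using (hC.clm_apply (hasDerivAt_const s u)).clm_apply (hasDerivAt_const s v)
  unfold wedgeBilin
  exact ((((h1 er).mul (h2 eθ et)).add ((h1 eθ).mul (h2 et er))).add
    ((h1 et).mul (h2 er eθ))).congr_deriv (by ring)

theorem isBoundedLinearMap_skew : IsBoundedLinearMap ℝ skew where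
  map_add A B := by
    refine ContinuousLinearMap.ext fun u => ContinuousLinearMap.ext fun v => ?_
    simp only [skew_apply, add_apply]
    ring
  map_smul c A := by
    refine ContinuousLinearMap.ext fun u => ContinuousLinearMap.ext fun v => ?_
    simp only [skew_apply, smul_apply, smul_eq_mul]
    ring
  bound := ⟨2, two_pos, fun A => by
    have h : ‖A - A.flip‖ ≤ ‖A‖ + ‖A.flip‖ := norm_sub_le A A.flip
    rwa [ContinuousLinearMap.opNorm_flip, ← two_mul] at h⟩

theorem hasDerivAt_skew {A : ℝ → Coord →L[ℝ] Coord →L[ℝ] ℝ} {A' : Coord →L[ℝ] Coord →L[ℝ] ℝ}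
    {s : ℝ} (h : HasDerivAt A A' s) : HasDerivAt (fun σ => skew (A σ)) (skew A') s :=
  HasFDerivAt.comp_hasDerivAt (l := skew)
    (l' := isBoundedLinearMap_skew.toContinuousLinearMap skew) s
    (IsBoundedLinearMap.hasFDerivAt (E := Coord →L[ℝ] Coord →L[ℝ] ℝ)
      (F := Coord →L[ℝ] Coord →L[ℝ] ℝ) isBoundedLinearMap_skew) h

theorem contDiffOn_skew {E : Type*} [NormedAddCommGroup E] [NormedSpace ℝ E]
    {n : WithTop ℕ∞} {U : Set E} {A : E → Coord →L[ℝ] Coord →L[ℝ] ℝ} (h : ContDiffOn ℝ n A U) :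
    ContDiffOn ℝ n (fun y => skew (A y)) U :=
  ContDiff.comp_contDiffOn (g := skew) (IsBoundedLinearMap.contDiff
    (E := Coord →L[ℝ] Coord →L[ℝ] ℝ) (F := Coord →L[ℝ] Coord →L[ℝ] ℝ) isBoundedLinearMap_skew) h

theorem contDiffOn_wedgeBilin {E : Type*} [NormedAddCommGroup E] [NormedSpace ℝ E]
    {n : WithTop ℕ∞} {U : Set E} {α : E → Coord →L[ℝ] ℝ} {C : E → Coord →L[ℝ] Coord →L[ℝ] ℝ}
    (hα : ContDiffOn ℝ n α U) (hC : ContDiffOn ℝ n C U) :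
    ContDiffOn ℝ n (fun y => wedgeBilin (α y) (C y)) U := by
  have h1 : ∀ u, ContDiffOn ℝ n (fun y => α y u) U := fun u => hα.clm_apply contDiffOn_const
  have h2 : ∀ u v, ContDiffOn ℝ n (fun y => C y u v) U := fun u v =>
    (hC.clm_apply contDiffOn_const).clm_apply contDiffOn_const
  exact (((h1 er).mul (h2 eθ et)).add ((h1 eθ).mul (h2 et er))).add ((h1 et).mul (h2 er eθ))

theorem contDiffOn_wedge {E : Type*} [NormedAddCommGroup E] [NormedSpace ℝ E]
    {n : WithTop ℕ∞} {U : Set E} {α β : E → Coord →L[ℝ] ℝ}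
    (hα : ContDiffOn ℝ n α U) (hβ : ContDiffOn ℝ n β U) (u v : Coord) :
    ContDiffOn ℝ n (fun y => wedge (α y) (β y) u v) U := by
  have h1 : ∀ u, ContDiffOn ℝ n (fun y => α y u) U := fun u => hα.clm_apply contDiffOn_const
  have h2 : ∀ u, ContDiffOn ℝ n (fun y => β y u) U := fun u => hβ.clm_apply contDiffOn_const
  exact ((h1 u).mul (h2 v)).sub ((h1 v).mul (h2 u))

theorem isOpen_region (r₀ : ℝ) : IsOpen (region r₀) := isOpen_Ioo.preimage continuous_fst

theorem cell_subset_region (r₀ : ℝ) : cell r₀ ⊆ region r₀ := fun _ hx => hx.1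

theorem measurableSet_cell (r₀ : ℝ) : MeasurableSet (cell r₀) :=
  measurableSet_Ioo.prod (measurableSet_Ioc.prod measurableSet_Ioc)

namespace Variation

variable {k : ℕ∞} {r₀ : ℝ} {f : ℝ → ℝ} (V : Variation k r₀ f)

/-! ### The derivatives of the densities along a variation -/

theorem zero_mem : (0 : ℝ) ∈ Ioo (-V.ε) V.ε := ⟨by linarith [V.ε_pos], V.ε_pos⟩

theorem contDiffOn_ω_three (hk : 3 ≤ k) (c : Bool) :
    ContDiffOn ℝ 3 (fun y : ℝ × Coord => V.ω c y.1 y.2) (Ioo (-V.ε) V.ε ×ˢ region r₀) :=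
  (V.contDiffOn_ω c).of_le (WithTop.coe_le_coe.2 hk)

theorem contDiffOn_T_three (hk : 3 ≤ k) (c : Bool) :
    ContDiffOn ℝ 3 (fun y : ℝ × Coord => V.T c y.1 y.2) (Ioo (-V.ε) V.ε ×ˢ region r₀) :=
  (V.contDiffOn_T c).of_le (WithTop.coe_le_coe.2 hk)

theorem contDiffOn_skew_fderiv_ω (hk : 3 ≤ k) (c : Bool) :
    ContDiffOn ℝ 2 (fun y : ℝ × Coord => skew (fderiv ℝ (V.ω c y.1) y.2))
      (Ioo (-V.ε) V.ε ×ˢ region r₀) :=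
  contDiffOn_skew (contDiffOn_fderiv_slice (m := 2) isOpen_Ioo
    (isOpen_region r₀) (V.contDiffOn_ω_three hk c) (by norm_num))

section

variable {V} {c : Bool} {s : ℝ} {x : Coord}

theorem differentiableAt_ω (hk : 3 ≤ k) (hs : s ∈ Ioo (-V.ε) V.ε) (hx : x ∈ region r₀) :
    DifferentiableAt ℝ (V.ω c s) x :=
  (hasFDerivAt_slice (differentiableAt_joint isOpen_Ioo (isOpen_region r₀)
    (V.contDiffOn_ω_three hk c) (by norm_num) hs hx)).differentiableAt

theorem η_eq (hk : 3 ≤ k) (hs : s ∈ Ioo (-V.ε) V.ε) (hx : x ∈ region r₀) :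
    V.η c s x = skew (fderiv ℝ (V.ω c s) x) (V.T c s x) :=
  contract_dForm (differentiableAt_ω hk hs hx) _

end

theorem contDiffOn_η (hk : 3 ≤ k) (c : Bool) :
    ContDiffOn ℝ 2 (fun y : ℝ × Coord => V.η c y.1 y.2) (Ioo (-V.ε) V.ε ×ˢ region r₀) :=
  ((V.contDiffOn_skew_fderiv_ω hk c).clm_apply
    ((V.contDiffOn_T_three hk c).of_le (by norm_num))).congr fun _ hy => η_eq hk hy.1 hy.2

theorem contDiffOn_skew_fderiv_η (hk : 3 ≤ k) (c : Bool) :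
    ContDiffOn ℝ 1 (fun y : ℝ × Coord => skew (fderiv ℝ (V.η c y.1) y.2))
      (Ioo (-V.ε) V.ε ×ˢ region r₀) :=
  contDiffOn_skew (contDiffOn_fderiv_slice (m := 1) isOpen_Ioo
    (isOpen_region r₀) (V.contDiffOn_η hk c) (by norm_num))

section

variable {V} {c : Bool} {s : ℝ} {x : Coord}

theorem differentiableAt_η (hk : 3 ≤ k) (hs : s ∈ Ioo (-V.ε) V.ε) (hx : x ∈ region r₀) :
    DifferentiableAt ℝ (V.η c s) x :=
  (hasFDerivAt_slice (differentiableAt_joint isOpen_Ioo (isOpen_region r₀)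
    (V.contDiffOn_η hk c) (by norm_num) hs hx)).differentiableAt

theorem gvDensity_eq (hk : 3 ≤ k) (hs : s ∈ Ioo (-V.ε) V.ε) (hx : x ∈ region r₀) :
    V.gvDensity c s x = wedgeBilin (V.η c s x) (skew (fderiv ℝ (V.η c s) x)) :=
  wedgeTop_dForm (differentiableAt_η hk hs hx) _

theorem intDensity_eq (hk : 3 ≤ k) (hs : s ∈ Ioo (-V.ε) V.ε) (hx : x ∈ region r₀) :
    V.intDensity c s x = wedgeBilin (V.ω c s x) (skew (fderiv ℝ (V.ω c s) x)) :=
  wedgeTop_dForm (differentiableAt_ω hk hs hx) _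

end

theorem contDiffOn_gvDensity (hk : 3 ≤ k) (c : Bool) :
    ContDiffOn ℝ 1 (fun y : ℝ × Coord => V.gvDensity c y.1 y.2)
      (Ioo (-V.ε) V.ε ×ˢ region r₀) :=
  (contDiffOn_wedgeBilin ((V.contDiffOn_η hk c).of_le (by norm_num))
    (V.contDiffOn_skew_fderiv_η hk c)).congr fun _ hy => gvDensity_eq hk hy.1 hy.2

theorem contDiffOn_intDensity (hk : 3 ≤ k) (c : Bool) :
    ContDiffOn ℝ 1 (fun y : ℝ × Coord => V.intDensity c y.1 y.2)
      (Ioo (-V.ε) V.ε ×ˢ region r₀) :=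
  (contDiffOn_wedgeBilin ((V.contDiffOn_ω_three hk c).of_le (by norm_num))
    ((V.contDiffOn_skew_fderiv_ω hk c).of_le (by norm_num))).congr
      fun _ hy => intDensity_eq hk hy.1 hy.2

/-- `Ṫ`, the derivative of `T_s` at `s = 0`. -/
def TDot (c : Bool) (x : Coord) : Coord := deriv (fun s => V.T c s x) 0

/-- The one-form `ι_T dη` at `s = 0`. -/
def iotaDη (c : Bool) (x : Coord) : Coord →L[ℝ] ℝ := contract (V.T c 0 x) (dForm (V.η c 0) x)

theorem contDiffOn_ωDot (hk : 3 ≤ k) (c : Bool) : ContDiffOn ℝ 2 (V.ωDot c) (region r₀) :=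
  contDiffOn_slice (G := fun s x => deriv (fun σ => V.ω c σ x) s)
    (contDiffOn_deriv_slice isOpen_Ioo (isOpen_region r₀) (V.contDiffOn_ω_three hk c)
      (by norm_num)) V.zero_mem

theorem contDiffOn_ηDot (hk : 3 ≤ k) (c : Bool) : ContDiffOn ℝ 1 (V.ηDot c) (region r₀) :=
  contDiffOn_slice (G := fun s x => deriv (fun σ => V.η c σ x) s)
    (contDiffOn_deriv_slice isOpen_Ioo (isOpen_region r₀) (V.contDiffOn_η hk c)
      (by norm_num)) V.zero_mem

theorem contDiffOn_iotaDη (hk : 3 ≤ k) (c : Bool) :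
    ContDiffOn ℝ 1 (V.iotaDη c) (region r₀) := by
  refine (contDiffOn_slice (G := fun s x => skew (fderiv ℝ (V.η c s) x) (V.T c s x))
    ((V.contDiffOn_skew_fderiv_η hk c).clm_apply
      ((V.contDiffOn_T_three hk c).of_le (by norm_num))) V.zero_mem).congr fun x hx => ?_
  exact contract_dForm (differentiableAt_η hk V.zero_mem hx) _

theorem contDiffOn_gvBoundary (hk : 3 ≤ k) (c : Bool) (u v : Coord) :
    ContDiffOn ℝ 1 (fun x => V.gvBoundary c x u v) (region r₀) :=
  (contDiffOn_wedge ((contDiffOn_slice (V.contDiffOn_η hk c) V.zero_mem).of_le (by norm_num))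
    (V.contDiffOn_ηDot hk c) u v).add (contDiffOn_const.mul
      (contDiffOn_wedge ((V.contDiffOn_ωDot hk c).of_le (by norm_num))
        (V.contDiffOn_iotaDη hk c) u v))

theorem contDiffOn_intBoundary (hk : 3 ≤ k) (c : Bool) (u v : Coord) :
    ContDiffOn ℝ 1 (fun x => V.intBoundary c x u v) (region r₀) :=
  contDiffOn_wedge
    ((contDiffOn_slice (V.contDiffOn_ω_three hk c) V.zero_mem).of_le (by norm_num))
    ((V.contDiffOn_ωDot hk c).of_le (by norm_num)) u v

section

variable {V} {c : Bool} {x : Coord}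

theorem hasDerivAt_ω (hk : 3 ≤ k) (hx : x ∈ region r₀) :
    HasDerivAt (fun s => V.ω c s x) (V.ωDot c x) 0 :=
  (hasDerivAt_slice (differentiableAt_joint isOpen_Ioo (isOpen_region r₀)
    (V.contDiffOn_ω_three hk c) (by norm_num) V.zero_mem hx)).differentiableAt.hasDerivAt

theorem hasDerivAt_T (hk : 3 ≤ k) (hx : x ∈ region r₀) :
    HasDerivAt (fun s => V.T c s x) (V.TDot c x) 0 :=
  (hasDerivAt_slice (differentiableAt_joint isOpen_Ioo (isOpen_region r₀)
    (V.contDiffOn_T_three hk c) (by norm_num) V.zero_mem hx)).differentiableAt.hasDerivAt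

theorem hasDerivAt_η (hk : 3 ≤ k) (hx : x ∈ region r₀) :
    HasDerivAt (fun s => V.η c s x) (V.ηDot c x) 0 :=
  (hasDerivAt_slice (differentiableAt_joint isOpen_Ioo (isOpen_region r₀)
    (V.contDiffOn_η hk c) (by norm_num) V.zero_mem hx)).differentiableAt.hasDerivAt

theorem hasDerivAt_skew_fderiv_ω (hk : 3 ≤ k) (hx : x ∈ region r₀) :
    HasDerivAt (fun s => skew (fderiv ℝ (V.ω c s) x)) (skew (fderiv ℝ (V.ωDot c) x)) 0 :=
  hasDerivAt_skew (hasDerivAt_fderiv_slice isOpen_Ioo (isOpen_region r₀)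
    (V.contDiffOn_ω_three hk c) (by norm_num) V.zero_mem hx)

theorem hasDerivAt_skew_fderiv_η (hk : 3 ≤ k) (hx : x ∈ region r₀) :
    HasDerivAt (fun s => skew (fderiv ℝ (V.η c s) x)) (skew (fderiv ℝ (V.ηDot c) x)) 0 :=
  hasDerivAt_skew (hasDerivAt_fderiv_slice isOpen_Ioo (isOpen_region r₀)
    (V.contDiffOn_η hk c) le_rfl V.zero_mem hx)

/-- `η̇ = ι_T dω̇ + ι_Ṫ dω`. -/
theorem ηDot_eq (hk : 3 ≤ k) (hx : x ∈ region r₀) :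
    V.ηDot c x = skew (fderiv ℝ (V.ωDot c) x) (V.T c 0 x)
      + skew (fderiv ℝ (V.ω c 0) x) (V.TDot c x) := by
  refine HasDerivAt.unique (hasDerivAt_η hk hx) ?_
  refine ((hasDerivAt_skew_fderiv_ω hk hx).clm_apply (hasDerivAt_T hk hx)).congr_of_eventuallyEq ?_
  filter_upwards [isOpen_Ioo.mem_nhds V.zero_mem] with s hs
  exact η_eq hk hs hx

/-- The first variation of `ω ∧ dω`: an Euler–Lagrange term and an exact term. -/
theorem hasDerivAt_intDensity (hk : 3 ≤ k) (hx : x ∈ region r₀) :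
    HasDerivAt (fun s => V.intDensity c s x)
      (2 * wedgeBilin (V.ωDot c x) (skew (fderiv ℝ (V.ω c 0) x))
        - divTwo (V.intBoundary c) x) 0 := by
  have hnhds := (isOpen_region r₀).mem_nhds hx
  have h := (hasDerivAt_wedgeBilin (hasDerivAt_ω (V := V) (c := c) hk hx)
    (hasDerivAt_skew_fderiv_ω (V := V) (c := c) hk hx)).congr_of_eventuallyEq
    (f₁ := fun s => V.intDensity c s x) (by
      filter_upwards [isOpen_Ioo.mem_nhds V.zero_mem] with s hs
      exact intDensity_eq hk hs hx)
  have e := divTwo_wedge (differentiableAt_ω (c := c) hk V.zero_mem hx)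
    (((V.contDiffOn_ωDot hk c).contDiffAt hnhds).differentiableAt two_ne_zero)
  refine h.congr_deriv ?_
  rw [show V.intBoundary c = fun y => wedge (V.ω c 0 y) (V.ωDot c y) from rfl, e]
  ring

/-- The first variation of `η ∧ dη`. The terms are the Euler–Lagrange terms
`2 ι_Ṫ dω ∧ dη` and `-2 ω̇ ∧ d(ι_T dη)` and an exact term. -/
theorem hasDerivAt_gvDensity (hk : 3 ≤ k) (hx : x ∈ region r₀) :
    HasDerivAt (fun s => V.gvDensity c s x)
      (2 * wedgeBilin (skew (fderiv ℝ (V.ω c 0) x) (V.TDot c x)) (skew (fderiv ℝ (V.η c 0) x))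
        - 2 * wedgeBilin (V.ωDot c x) (skew (fderiv ℝ (V.iotaDη c) x))
        - divTwo (V.gvBoundary c) x) 0 := by
  have hnhds := (isOpen_region r₀).mem_nhds hx
  have h := (hasDerivAt_wedgeBilin (hasDerivAt_η (V := V) (c := c) hk hx)
    (hasDerivAt_skew_fderiv_η (V := V) (c := c) hk hx)).congr_of_eventuallyEq
    (f₁ := fun s => V.gvDensity c s x) (by
      filter_upwards [isOpen_Ioo.mem_nhds V.zero_mem] with s hs
      exact gvDensity_eq hk hs hx)
  have dη := differentiableAt_η (c := c) hk V.zero_mem hx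
  have dη' := ((V.contDiffOn_ηDot hk c).contDiffAt hnhds).differentiableAt one_ne_zero
  have dω' := ((V.contDiffOn_ωDot hk c).contDiffAt hnhds).differentiableAt two_ne_zero
  have dζ := ((V.contDiffOn_iotaDη hk c).contDiffAt hnhds).differentiableAt one_ne_zero
  have e1 := divTwo_wedge dη dη'
  have e2 := divTwo_wedge dω' dζ
  have e : divTwo (V.gvBoundary c) x =
      divTwo (fun y => wedge (V.η c 0 y) (V.ηDot c y)) x
        + 2 * divTwo (fun y => wedge (V.ωDot c y) (V.iotaDη c y)) x :=
    divTwo_add_mul 2 (differentiableAt_wedge dη dη') (differentiableAt_wedge dω' dζ)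
  have hζ : V.iotaDη c x = skew (fderiv ℝ (V.η c 0) x) (V.T c 0 x) := contract_dForm dη _
  have e3 := wedgeBilin_contract_antisymm (fderiv ℝ (V.ωDot c) x) (fderiv ℝ (V.η c 0) x)
    (V.T c 0 x)
  have e4 : wedgeBilin (V.ηDot c x) (skew (fderiv ℝ (V.η c 0) x)) =
      wedgeBilin (skew (fderiv ℝ (V.ωDot c) x) (V.T c 0 x)) (skew (fderiv ℝ (V.η c 0) x))
      + wedgeBilin (skew (fderiv ℝ (V.ω c 0) x) (V.TDot c x)) (skew (fderiv ℝ (V.η c 0) x)) := by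
    rw [ηDot_eq hk hx]
    simp only [wedgeBilin, add_apply]
    ring
  refine h.congr_deriv ?_
  rw [e, e1, e2, hζ]
  linarith

end

end Variation
/-! ### The geometry of the Reeb pair -/

theorem hasFDerivAt_radial {a b c : ℝ → ℝ} {a' b' c' : ℝ} {x : Coord}
    (ha : HasDerivAt a a' x.1) (hb : HasDerivAt b b' x.1) (hc : HasDerivAt c c' x.1) :
    HasFDerivAt (fun y : Coord => covec (a y.1) (b y.1) (c y.1))
      ((ContinuousLinearMap.fst ℝ ℝ (ℝ × ℝ)).smulRight (covec a' b' c')) x := by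
  have h : HasDerivAt (fun r => covec (a r) (b r) (c r)) (covec a' b' c') x.1 :=
    ((ha.smul_const (ContinuousLinearMap.fst ℝ ℝ (ℝ × ℝ))).add
      (hb.smul_const ((ContinuousLinearMap.fst ℝ ℝ ℝ).comp
        (ContinuousLinearMap.snd ℝ ℝ (ℝ × ℝ))))).add
      (hc.smul_const ((ContinuousLinearMap.snd ℝ ℝ ℝ).comp (ContinuousLinearMap.snd ℝ ℝ (ℝ × ℝ))))
  exact HasFDerivAt.congr_fderiv (h.hasFDerivAt.comp x hasFDerivAt_fst)
    (ContinuousLinearMap.ext fun v => by simp)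

/-- The exterior derivative of a one-form whose coefficients depend on `r` only. -/
theorem skew_fderiv_radial {α : Coord → Coord →L[ℝ] ℝ} {a b c : ℝ → ℝ} {a' b' c' : ℝ} {x : Coord}
    (ha : HasDerivAt a a' x.1) (hb : HasDerivAt b b' x.1) (hc : HasDerivAt c c' x.1)
    (h : α =ᶠ[𝓝 x] fun y => covec (a y.1) (b y.1) (c y.1)) (u v : Coord) :
    skew (fderiv ℝ α x) u v =
      u.1 * (b' * v.2.1 + c' * v.2.2) - v.1 * (b' * u.2.1 + c' * u.2.2) := by
  rw [h.fderiv_eq, (hasFDerivAt_radial ha hb hc).fderiv, skew_apply]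
  simp [covec_apply]
  ring

theorem ext_covec {α : Coord →L[ℝ] ℝ} {a b c : ℝ}
    (h : ∀ v, α v = a * v.1 + b * v.2.1 + c * v.2.2) : α = covec a b c :=
  ContinuousLinearMap.ext fun v => by rw [h, covec_apply]

theorem reebSign_mul_self (c : Bool) : reebSign c * reebSign c = 1 := by
  cases c <;> simp [reebSign]

theorem reebForm_eq (r₀ : ℝ) (f : ℝ → ℝ) (c : Bool) (x : Coord) :
    reebForm r₀ f c x = covec (-(reebSign c * Real.sin (reebAngle r₀ f x.1))) 0
      (reebSign c * Real.cos (reebAngle r₀ f x.1)) :=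
  ext_covec fun v => by simp [reebForm, covec_apply]; ring

theorem reebField_eq (r₀ : ℝ) (f : ℝ → ℝ) (c : Bool) (x : Coord) :
    reebField r₀ f c x = (-(reebSign c * Real.sin (reebAngle r₀ f x.1)), 0,
      reebSign c * Real.cos (reebAngle r₀ f x.1)) := by
  simp [reebField, er, et]

variable {r₀ : ℝ} {f : ℝ → ℝ} {r : ℝ}

theorem reebAngle_eq (r₀ : ℝ) (f : ℝ → ℝ) : reebAngle r₀ f = fun r => Real.arctan (der r₀ f 1 r) := by
  ext r
  simp [reebAngle, der, iteratedDerivWithin_one]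

theorem continuousOn_der (hf : ContDiffOn ℝ 4 f (Ico 0 r₀)) {j : ℕ} (hj : j ≤ 4) :
    ContinuousOn (der r₀ f j) (Ico 0 r₀) :=
  hf.continuousOn_iteratedDerivWithin (by exact_mod_cast hj) (uniqueDiffOn_Ico 0 r₀)

theorem hasDerivAt_der (hf : ContDiffOn ℝ 4 f (Ico 0 r₀)) {j : ℕ} (hj : j ≤ 3)
    (hr : r ∈ Ioo 0 r₀) : HasDerivAt (der r₀ f j) (der r₀ f (j + 1) r) r := by
  have hn : Ico 0 r₀ ∈ 𝓝 r := Ico_mem_nhds hr.1 hr.2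
  have h : DifferentiableOn ℝ (iteratedDerivWithin j f (Ico 0 r₀)) (Ico 0 r₀) :=
    hf.differentiableOn_iteratedDerivWithin (by exact_mod_cast Nat.lt_succ_of_le hj)
      (uniqueDiffOn_Ico 0 r₀)
  have h2 := ((h r ⟨hr.1.le, hr.2⟩).hasDerivWithinAt).hasDerivAt hn
  rw [← iteratedDerivWithin_succ] at h2
  exact h2

/-- The derivative `μ' = f'' / (1 + (f')²)` of the angle. -/
def angleDeriv (r₀ : ℝ) (f : ℝ → ℝ) (r : ℝ) : ℝ := der r₀ f 2 r / (1 + der r₀ f 1 r ^ 2)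

/-- The function `h = μ' sin² μ`: the Reeb pair has `dη = h' dr ∧ dt`. -/
def gvCoeff (r₀ : ℝ) (f : ℝ → ℝ) (r : ℝ) : ℝ :=
  angleDeriv r₀ f r * Real.sin (reebAngle r₀ f r) ^ 2

/-- The derivative of `h = μ' sin² μ = (f')² f'' / (1 + (f')²)²`, in terms of `f`. -/
def gvCoeffDeriv (r₀ : ℝ) (f : ℝ → ℝ) (r : ℝ) : ℝ :=
  der r₀ f 3 r * der r₀ f 1 r ^ 2 / (1 + der r₀ f 1 r ^ 2) ^ 2
    + 2 * der r₀ f 1 r * der r₀ f 2 r ^ 2 * (1 - der r₀ f 1 r ^ 2) / (1 + der r₀ f 1 r ^ 2) ^ 3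

/-- The function `h' sin μ`, a first integral of the Euler–Lagrange equation of `gv`. -/
def gvMomentum (r₀ : ℝ) (f : ℝ → ℝ) (r : ℝ) : ℝ :=
  gvCoeffDeriv r₀ f r * Real.sin (reebAngle r₀ f r)

/-- The second derivative of `h = μ' sin² μ`, in terms of `f`. -/
def gvCoeffDeriv₂ (r₀ : ℝ) (f : ℝ → ℝ) (r : ℝ) : ℝ :=
  der r₀ f 4 r * der r₀ f 1 r ^ 2 / (1 + der r₀ f 1 r ^ 2) ^ 2
    + 6 * der r₀ f 1 r * der r₀ f 2 r * der r₀ f 3 r * (1 - der r₀ f 1 r ^ 2)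
      / (1 + der r₀ f 1 r ^ 2) ^ 3
    + der r₀ f 2 r ^ 3 * (2 - 16 * der r₀ f 1 r ^ 2 + 6 * der r₀ f 1 r ^ 4)
      / (1 + der r₀ f 1 r ^ 2) ^ 4

/-- The Euler–Lagrange expression `(h' sin μ)' = h'' sin μ + h' μ' cos μ` of `gv`. -/
def gvEuler (r₀ : ℝ) (f : ℝ → ℝ) (r : ℝ) : ℝ :=
  gvCoeffDeriv₂ r₀ f r * Real.sin (reebAngle r₀ f r)
    + gvCoeffDeriv r₀ f r * (Real.cos (reebAngle r₀ f r) * angleDeriv r₀ f r)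

/-- The Euler–Lagrange expression `μ' sin μ` of `∫ ω ∧ dω`. -/
def intEuler (r₀ : ℝ) (f : ℝ → ℝ) (r : ℝ) : ℝ :=
  angleDeriv r₀ f r * Real.sin (reebAngle r₀ f r)

theorem hasDerivAt_reebAngle (hf : ContDiffOn ℝ 4 f (Ico 0 r₀)) (hr : r ∈ Ioo 0 r₀) :
    HasDerivAt (reebAngle r₀ f) (angleDeriv r₀ f r) r := by
  rw [reebAngle_eq]
  refine (hasDerivAt_der hf (by norm_num) hr).arctan.congr_deriv ?_
  rw [angleDeriv]
  ring

theorem hasDerivAt_angleDeriv (hf : ContDiffOn ℝ 4 f (Ico 0 r₀)) (hr : r ∈ Ioo 0 r₀) :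
    HasDerivAt (angleDeriv r₀ f) ((der r₀ f 3 r * (1 + der r₀ f 1 r ^ 2)
      - der r₀ f 2 r * (2 * der r₀ f 1 r * der r₀ f 2 r)) / (1 + der r₀ f 1 r ^ 2) ^ 2) r := by
  have h1 := hasDerivAt_der hf (j := 1) (by norm_num) hr
  have h2 := hasDerivAt_der hf (j := 2) (by norm_num) hr
  have e : 1 + der r₀ f 1 r ^ 2 ≠ 0 := by positivity
  refine (h2.div ((h1.pow 2).const_add 1) e).congr_deriv ?_
  simp

theorem sin_reebAngle_sq (r₀ : ℝ) (f : ℝ → ℝ) (r : ℝ) :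
    Real.sin (reebAngle r₀ f r) ^ 2 = der r₀ f 1 r ^ 2 / (1 + der r₀ f 1 r ^ 2) := by
  rw [reebAngle_eq, Real.sin_arctan, div_pow, Real.sq_sqrt (by positivity)]

theorem gvCoeff_eq (r₀ : ℝ) (f : ℝ → ℝ) (r : ℝ) :
    gvCoeff r₀ f r = der r₀ f 2 r * der r₀ f 1 r ^ 2 / (1 + der r₀ f 1 r ^ 2) ^ 2 := by
  rw [gvCoeff, angleDeriv, sin_reebAngle_sq]
  field_simp

theorem hasDerivAt_gvCoeff (hf : ContDiffOn ℝ 4 f (Ico 0 r₀)) (hr : r ∈ Ioo 0 r₀) :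
    HasDerivAt (gvCoeff r₀ f) (gvCoeffDeriv r₀ f r) r := by
  have h1 := hasDerivAt_der hf (j := 1) (by norm_num) hr
  have h2 := hasDerivAt_der hf (j := 2) (by norm_num) hr
  rw [funext (gvCoeff_eq r₀ f)]
  have e : (1 + der r₀ f 1 r ^ 2) ^ 2 ≠ 0 := by positivity
  refine ((h2.mul (h1.pow 2)).div (((h1.pow 2).const_add 1).pow 2) e).congr_deriv ?_
  rw [gvCoeffDeriv]
  simp
  field_simp
  ring

theorem hasDerivAt_gvCoeffDeriv (hf : ContDiffOn ℝ 4 f (Ico 0 r₀)) (hr : r ∈ Ioo 0 r₀) :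
    HasDerivAt (gvCoeffDeriv r₀ f) (gvCoeffDeriv₂ r₀ f r) r := by
  have h1 := hasDerivAt_der hf (j := 1) (by norm_num) hr
  have h2 := hasDerivAt_der hf (j := 2) (by norm_num) hr
  have h3 := hasDerivAt_der hf (j := 3) (by norm_num) hr
  have e1 : (1 + der r₀ f 1 r ^ 2) ^ 2 ≠ 0 := by positivity
  have e2 : (1 + der r₀ f 1 r ^ 2) ^ 3 ≠ 0 := by positivity
  have e0 : 1 + der r₀ f 1 r ^ 2 ≠ 0 := by positivity
  refine (((h3.mul (h1.pow 2)).div (((h1.pow 2).const_add 1).pow 2) e1).add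
    ((((h1.const_mul 2).mul (h2.pow 2)).mul ((h1.pow 2).const_sub 1)).div
      (((h1.pow 2).const_add 1).pow 3) e2)).congr_deriv ?_
  rw [gvCoeffDeriv₂]
  simp
  field_simp
  ring

theorem hasDerivAt_gvMomentum (hf : ContDiffOn ℝ 4 f (Ico 0 r₀)) (hr : r ∈ Ioo 0 r₀) :
    HasDerivAt (gvMomentum r₀ f) (gvEuler r₀ f r) r :=
  (hasDerivAt_gvCoeffDeriv hf hr).mul (hasDerivAt_reebAngle hf hr).sin

namespace Variation

variable {k : ℕ∞} {V : Variation k r₀ f} {c : Bool} {x : Coord}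

theorem eventually_mem_region (hx : x ∈ region r₀) : ∀ᶠ y in 𝓝 x, y ∈ region r₀ :=
  (isOpen_region r₀).mem_nhds hx

theorem skew_fderiv_ω_zero (hf : ContDiffOn ℝ 4 f (Ico 0 r₀)) (hx : x ∈ region r₀) (u v : Coord) :
    skew (fderiv ℝ (V.ω c 0) x) u v =
      -(reebSign c * intEuler r₀ f x.1) * (u.1 * v.2.2 - v.1 * u.2.2) := by
  have hμ := hasDerivAt_reebAngle hf hx
  rw [skew_fderiv_radial ((hμ.sin.const_mul (reebSign c)).neg) (hasDerivAt_const _ (0 : ℝ))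
    (hμ.cos.const_mul (reebSign c)) ?_]
  · rw [intEuler]
    ring
  · filter_upwards [eventually_mem_region hx] with y hy
    rw [V.ω_zero c y hy, reebForm_eq]
    rfl

theorem η_zero (hk : 3 ≤ k) (hf : ContDiffOn ℝ 4 f (Ico 0 r₀)) (hx : x ∈ region r₀) :
    V.η c 0 x = covec (intEuler r₀ f x.1 * Real.cos (reebAngle r₀ f x.1)) 0
      (gvCoeff r₀ f x.1) := by
  refine ext_covec fun v => ?_
  rw [η_eq hk V.zero_mem hx, skew_fderiv_ω_zero hf hx, V.T_zero c x hx, reebField_eq, gvCoeff,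
    intEuler]
  linear_combination (angleDeriv r₀ f x.1 * Real.sin (reebAngle r₀ f x.1) *
    (Real.cos (reebAngle r₀ f x.1) * v.1 + Real.sin (reebAngle r₀ f x.1) * v.2.2)) *
    reebSign_mul_self c

theorem skew_fderiv_η_zero (hk : 3 ≤ k) (hf : ContDiffOn ℝ 4 f (Ico 0 r₀)) (hx : x ∈ region r₀)
    (u v : Coord) :
    skew (fderiv ℝ (V.η c 0) x) u v =
      gvCoeffDeriv r₀ f x.1 * (u.1 * v.2.2 - v.1 * u.2.2) := by
  have hμ := hasDerivAt_reebAngle hf hx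
  rw [skew_fderiv_radial (((hasDerivAt_angleDeriv hf hx).mul hμ.sin).mul hμ.cos)
    (hasDerivAt_const _ (0 : ℝ)) (hasDerivAt_gvCoeff hf hx) ?_]
  · ring
  · filter_upwards [eventually_mem_region hx] with y hy
    exact η_zero hk hf hy

theorem iotaDη_eq (hk : 3 ≤ k) (hf : ContDiffOn ℝ 4 f (Ico 0 r₀)) (hx : x ∈ region r₀) :
    V.iotaDη c x = covec
      (-reebSign c * (gvCoeffDeriv r₀ f x.1 * Real.cos (reebAngle r₀ f x.1))) 0
      (-reebSign c * gvMomentum r₀ f x.1) := by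
  refine ext_covec fun v => ?_
  rw [iotaDη, contract_dForm (differentiableAt_η hk V.zero_mem hx), skew_fderiv_η_zero hk hf hx,
    V.T_zero c x hx, reebField_eq, gvMomentum]
  ring

theorem skew_fderiv_iotaDη (hk : 3 ≤ k) (hf : ContDiffOn ℝ 4 f (Ico 0 r₀)) (hx : x ∈ region r₀)
    (u v : Coord) :
    skew (fderiv ℝ (V.iotaDη c) x) u v =
      -(reebSign c * gvEuler r₀ f x.1) * (u.1 * v.2.2 - v.1 * u.2.2) := by
  have hμ := hasDerivAt_reebAngle hf hx
  rw [skew_fderiv_radial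
    (((hasDerivAt_gvCoeffDeriv hf hx).mul hμ.cos).const_mul (-reebSign c))
    (hasDerivAt_const _ (0 : ℝ)) ((hasDerivAt_gvMomentum hf hx).const_mul (-reebSign c)) ?_]
  · ring
  · filter_upwards [eventually_mem_region hx] with y hy
    exact iotaDη_eq hk hf hy

/-- For the Reeb pair, `dω` and `dη` are multiples of `dr ∧ dt`, so only the coefficient of `dθ`
in `ω̇` contributes to the first variation of `gv`, up to an exact term. -/
theorem hasDerivAt_gvDensity_reeb (hk : 3 ≤ k) (hf : ContDiffOn ℝ 4 f (Ico 0 r₀))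
    (hx : x ∈ region r₀) :
    HasDerivAt (fun s => V.gvDensity c s x)
      (-(2 * reebSign c * (V.ωDot c x eθ * gvEuler r₀ f x.1)) - divTwo (V.gvBoundary c) x) 0 := by
  refine (hasDerivAt_gvDensity hk hx).congr_deriv ?_
  simp only [wedgeBilin, skew_fderiv_ω_zero hf hx, skew_fderiv_η_zero hk hf hx,
    skew_fderiv_iotaDη hk hf hx, er, eθ, et]
  ring

theorem hasDerivAt_intDensity_reeb (hk : 3 ≤ k) (hf : ContDiffOn ℝ 4 f (Ico 0 r₀))
    (hx : x ∈ region r₀) :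
    HasDerivAt (fun s => V.intDensity c s x)
      (2 * reebSign c * (V.ωDot c x eθ * intEuler r₀ f x.1) - divTwo (V.intBoundary c) x) 0 := by
  refine (hasDerivAt_intDensity hk hx).congr_deriv ?_
  simp only [wedgeBilin, skew_fderiv_ω_zero hf hx, er, eθ, et]
  ring

theorem gvDensity_zero (hk : 3 ≤ k) (hf : ContDiffOn ℝ 4 f (Ico 0 r₀)) (hx : x ∈ region r₀) :
    V.gvDensity c 0 x = 0 := by
  rw [gvDensity_eq hk V.zero_mem hx, η_zero hk hf hx]
  simp [wedgeBilin, skew_fderiv_η_zero hk hf hx, er, eθ, et, covec_apply]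

theorem intDensity_zero (hk : 3 ≤ k) (hf : ContDiffOn ℝ 4 f (Ico 0 r₀)) (hx : x ∈ region r₀) :
    V.intDensity c 0 x = 0 := by
  rw [intDensity_eq hk V.zero_mem hx, V.ω_zero c x hx, reebForm_eq]
  simp [wedgeBilin, skew_fderiv_ω_zero hf hx, er, eθ, et, covec_apply]

end Variation
/-! ### Integrals of exact forms over a punctured solid torus -/

/-- A fundamental domain of the torus of angles. -/
def angleCell : Set (ℝ × ℝ) := Ioc 0 (2 * Real.pi) ×ˢ Ioc 0 (2 * Real.pi)

theorem cell_eq (r₀ : ℝ) : cell r₀ = Ioo 0 r₀ ×ˢ angleCell := rfl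

theorem volume_restrict_prod (s : Set ℝ) (t : Set (ℝ × ℝ)) :
    (volume : Measure Coord).restrict (s ×ˢ t) = (volume.restrict s).prod (volume.restrict t) := by
  rw [Measure.volume_eq_prod, Measure.prod_restrict]

theorem volume_restrict_prod_real (s t : Set ℝ) :
    (volume : Measure (ℝ × ℝ)).restrict (s ×ˢ t) =
      (volume.restrict s).prod (volume.restrict t) := by
  rw [Measure.volume_eq_prod, Measure.prod_restrict]

theorem volume_real_angleCell : volume.real angleCell = (2 * Real.pi) ^ 2 := by
  have h : (0 : ℝ) ≤ 2 * Real.pi := by positivity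
  rw [angleCell, Measure.volume_eq_prod, measureReal_prod_prod, Real.volume_real_Ioc_of_le h]
  ring

theorem volume_angleCell_lt_top : volume angleCell < ⊤ := by
  rw [angleCell, Measure.volume_eq_prod, Measure.prod_prod]
  exact ENNReal.mul_lt_top measure_Ioc_lt_top measure_Ioc_lt_top

variable {r₀ : ℝ} {G : Coord → ℝ}

theorem integrableOn_of_continuousOn_region (hG : ContinuousOn G (region r₀)) {a b : ℝ}
    (ha : 0 < a) (hb : b < r₀) : IntegrableOn G (Icc a b ×ˢ angleCell) := by
  have hK : IsCompact (Icc a b ×ˢ (Icc 0 (2 * Real.pi) ×ˢ Icc 0 (2 * Real.pi))) :=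
    isCompact_Icc.prod (isCompact_Icc.prod isCompact_Icc)
  have hsub : Icc a b ×ˢ (Icc 0 (2 * Real.pi) ×ˢ Icc 0 (2 * Real.pi)) ⊆ region r₀ :=
    fun x hx => ⟨ha.trans_le hx.1.1, hx.1.2.trans_lt hb⟩
  exact ((hG.mono hsub).integrableOn_compact hK).mono_set
    (prod_mono le_rfl (prod_mono Ioc_subset_Icc_self Ioc_subset_Icc_self))

theorem integrableOn_slice_of_continuousOn_region (hG : ContinuousOn G (region r₀)) {r : ℝ}
    (hr : r ∈ Ioo 0 r₀) : IntegrableOn (fun y => G (r, y)) angleCell := by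
  have hK : IsCompact (Icc 0 (2 * Real.pi) ×ˢ Icc 0 (2 * Real.pi)) :=
    isCompact_Icc.prod isCompact_Icc
  have h : ContinuousOn (fun y : ℝ × ℝ => G (r, y)) (Icc 0 (2 * Real.pi) ×ˢ Icc 0 (2 * Real.pi)) :=
    hG.comp (by fun_prop) fun y _ => hr
  exact (h.integrableOn_compact hK).mono_set (prod_mono Ioc_subset_Icc_self Ioc_subset_Icc_self)

theorem hasDerivAt_fderiv_line {x v : Coord} {γ : ℝ → Coord} {s : ℝ} (hG : DifferentiableAt ℝ G x)
    (hγ : HasDerivAt γ v s) (hx : γ s = x) : HasDerivAt (fun s => G (γ s)) (fderiv ℝ G x v) s := by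
  subst hx
  exact hG.hasFDerivAt.comp_hasDerivAt s hγ

theorem differentiableAt_of_region (hG : ContDiffOn ℝ 1 G (region r₀)) {x : Coord}
    (hx : x ∈ region r₀) : DifferentiableAt ℝ G x :=
  (hG.contDiffAt ((isOpen_region r₀).mem_nhds hx)).differentiableAt one_ne_zero

theorem continuousOn_fderiv_region (hG : ContDiffOn ℝ 1 G (region r₀)) (v : Coord) :
    ContinuousOn (fun x => fderiv ℝ G x v) (region r₀) :=
  (hG.continuousOn_fderiv_of_isOpen (isOpen_region r₀) le_rfl).clm_apply continuousOn_const

/-- The average of a `θ`-derivative over the angles vanishes. -/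
theorem integral_fderiv_eθ (hG : ContDiffOn ℝ 1 G (region r₀))
    (hper : ∀ x ∈ region r₀, G (x + (2 * Real.pi) • eθ) = G x) {r : ℝ} (hr : r ∈ Ioo 0 r₀) :
    ∫ y in angleCell, fderiv ℝ G (r, y) eθ = 0 := by
  have hint := integrableOn_slice_of_continuousOn_region (continuousOn_fderiv_region hG eθ) hr
  rw [IntegrableOn, angleCell, volume_restrict_prod_real] at hint
  rw [angleCell, volume_restrict_prod_real, integral_prod_symm _ hint]
  refine integral_eq_zero_of_ae (Eventually.of_forall fun t => ?_)
  have hpi : (0 : ℝ) ≤ 2 * Real.pi := by positivity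
  have hd : ∀ θ : ℝ, HasDerivAt (fun θ => G (r, θ, t)) (fderiv ℝ G (r, θ, t) eθ) θ := fun θ =>
    hasDerivAt_fderiv_line (γ := fun θ => (r, θ, t)) (differentiableAt_of_region hG hr)
      ((hasDerivAt_const θ r).prodMk ((hasDerivAt_id θ).prodMk (hasDerivAt_const θ t))) rfl
  have hc : Continuous fun θ : ℝ => fderiv ℝ G (r, θ, t) eθ :=
    (continuousOn_fderiv_region hG eθ).comp_continuous (by fun_prop) fun _ => hr
  have := intervalIntegral.integral_eq_sub_of_hasDerivAt (a := 0) (b := 2 * Real.pi)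
    (fun θ _ => hd θ) (hc.intervalIntegrable _ _)
  rw [intervalIntegral.integral_of_le hpi] at this
  refine this.trans (sub_eq_zero.2 ?_)
  convert hper (r, 0, t) hr using 2
  simp [eθ]

/-- The average of a `t`-derivative over the angles vanishes. -/
theorem integral_fderiv_et (hG : ContDiffOn ℝ 1 G (region r₀))
    (hper : ∀ x ∈ region r₀, G (x + (2 * Real.pi) • et) = G x) {r : ℝ} (hr : r ∈ Ioo 0 r₀) :
    ∫ y in angleCell, fderiv ℝ G (r, y) et = 0 := by
  have hint := integrableOn_slice_of_continuousOn_region (continuousOn_fderiv_region hG et) hr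
  rw [IntegrableOn, angleCell, volume_restrict_prod_real] at hint
  rw [angleCell, volume_restrict_prod_real, integral_prod _ hint]
  refine integral_eq_zero_of_ae (Eventually.of_forall fun θ => ?_)
  have hpi : (0 : ℝ) ≤ 2 * Real.pi := by positivity
  have hd : ∀ t : ℝ, HasDerivAt (fun t => G (r, θ, t)) (fderiv ℝ G (r, θ, t) et) t := fun t =>
    hasDerivAt_fderiv_line (γ := fun t => (r, θ, t)) (differentiableAt_of_region hG hr)
      ((hasDerivAt_const t r).prodMk ((hasDerivAt_const t θ).prodMk (hasDerivAt_id t))) rfl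
  have hc : Continuous fun t : ℝ => fderiv ℝ G (r, θ, t) et :=
    (continuousOn_fderiv_region hG et).comp_continuous (by fun_prop) fun _ => hr
  have := intervalIntegral.integral_eq_sub_of_hasDerivAt (a := 0) (b := 2 * Real.pi)
    (fun θ _ => hd θ) (hc.intervalIntegrable _ _)
  rw [intervalIntegral.integral_of_le hpi] at this
  refine this.trans (sub_eq_zero.2 ?_)
  convert hper (r, θ, 0) hr using 2
  simp [et]

theorem setIntegral_fderiv_er (hG : ContDiffOn ℝ 1 G (region r₀)) {a b : ℝ} (ha : 0 < a)
    (hab : a ≤ b) (hb : b < r₀) :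
    ∫ x in Ioc a b ×ˢ angleCell, fderiv ℝ G x er =
      ∫ y in angleCell, (G (b, y) - G (a, y)) := by
  have hint := (integrableOn_of_continuousOn_region (continuousOn_fderiv_region hG er) ha hb).mono_set
    (prod_mono Ioc_subset_Icc_self le_rfl)
  rw [IntegrableOn, volume_restrict_prod] at hint
  rw [volume_restrict_prod, integral_prod_symm _ hint]
  refine integral_congr_ae (Eventually.of_forall fun y => ?_)
  have hmem : ∀ r ∈ uIcc a b, ((r, y) : Coord) ∈ region r₀ := fun r hr => by
    rw [uIcc_of_le hab] at hr
    exact ⟨ha.trans_le hr.1, hr.2.trans_lt hb⟩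
  have hd : ∀ r ∈ uIcc a b, HasDerivAt (fun r => G (r, y)) (fderiv ℝ G (r, y) er) r := fun r hr =>
    hasDerivAt_fderiv_line (γ := fun r => (r, y)) (differentiableAt_of_region hG (hmem r hr))
      ((hasDerivAt_id r).prodMk (hasDerivAt_const r y)) rfl
  have hc : ContinuousOn (fun r : ℝ => fderiv ℝ G (r, y) er) (uIcc a b) :=
    (continuousOn_fderiv_region hG er).comp (by fun_prop) hmem
  have := intervalIntegral.integral_eq_sub_of_hasDerivAt hd hc.intervalIntegrable
  rwa [intervalIntegral.integral_of_le hab] at this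

variable {β : Coord → Coord → Coord → ℝ}

theorem continuousOn_divTwo (hβ : ∀ u v, ContDiffOn ℝ 1 (fun x => β x u v) (region r₀)) :
    ContinuousOn (divTwo β) (region r₀) :=
  ((continuousOn_fderiv_region (hβ eθ et) er).add (continuousOn_fderiv_region (hβ et er) eθ)).add
    (continuousOn_fderiv_region (hβ er eθ) et)

/-- Stokes' theorem on the shell `a < r ≤ b`. -/
theorem setIntegral_divTwo_shell (hβ : ∀ u v, ContDiffOn ℝ 1 (fun x => β x u v) (region r₀))
    (hθ : ∀ x ∈ region r₀, β (x + (2 * Real.pi) • eθ) = β x)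
    (ht : ∀ x ∈ region r₀, β (x + (2 * Real.pi) • et) = β x) {a b : ℝ} (ha : 0 < a)
    (hab : a ≤ b) (hb : b < r₀) :
    ∫ r in a..b, ∫ y in angleCell, divTwo β (r, y) =
      ∫ y in angleCell, (β (b, y) eθ et - β (a, y) eθ et) := by
  have hI : ∀ u v w, IntegrableOn (fun x => fderiv ℝ (fun y => β y u v) x w)
      (Ioc a b ×ˢ angleCell) := fun u v w =>
    (integrableOn_of_continuousOn_region (continuousOn_fderiv_region (hβ u v) w) ha hb).mono_set
      (prod_mono Ioc_subset_Icc_self le_rfl)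
  have h0 : ∀ u v w, (∀ r ∈ Ioo 0 r₀, ∫ y in angleCell, fderiv ℝ (fun y => β y u v) (r, y) w = 0) →
      ∫ x in Ioc a b ×ˢ angleCell, fderiv ℝ (fun y => β y u v) x w = 0 := fun u v w h => by
    have := hI u v w
    rw [IntegrableOn, volume_restrict_prod] at this
    rw [volume_restrict_prod, integral_prod _ this]
    refine setIntegral_eq_zero_of_forall_eq_zero fun r hr => ?_
    exact h r ⟨ha.trans hr.1, hr.2.trans_lt hb⟩
  have hd : IntegrableOn (divTwo β) (Ioc a b ×ˢ angleCell) :=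
    ((hI eθ et er).add (hI et er eθ)).add (hI er eθ et)
  have e : ∫ r in a..b, ∫ y in angleCell, divTwo β (r, y) =
      ∫ x in Ioc a b ×ˢ angleCell, divTwo β x := by
    rw [IntegrableOn, volume_restrict_prod] at hd
    rw [intervalIntegral.integral_of_le hab, volume_restrict_prod, integral_prod _ hd]
  rw [e, ← setIntegral_fderiv_er (hβ eθ et) ha hab hb]
  have hI2 : IntegrableOn (fun x => fderiv ℝ (fun y => β y eθ et) x er
      + fderiv ℝ (fun y => β y et er) x eθ) (Ioc a b ×ˢ angleCell) := (hI eθ et er).add (hI et er eθ)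
  unfold divTwo
  rw [integral_add hI2 (hI er eθ et),
    integral_add (hI eθ et er) (hI et er eθ),
    h0 et er eθ fun r hr => integral_fderiv_eθ (hβ et er) (fun x hx => by rw [hθ x hx]) hr,
    h0 er eθ et fun r hr => integral_fderiv_et (hβ er eθ) (fun x hx => by rw [ht x hx]) hr,
    add_zero, add_zero]

/-- The Cauchy–Schwarz inequality on the torus of angles. -/
theorem sq_integral_angleCell_le {g : ℝ × ℝ → ℝ} (h1 : IntegrableOn g angleCell)
    (h2 : IntegrableOn (fun y => g y ^ 2) angleCell) :
    (∫ y in angleCell, g y) ^ 2 ≤ (2 * Real.pi) ^ 2 * ∫ y in angleCell, g y ^ 2 := by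
  have hA : (0 : ℝ) < (2 * Real.pi) ^ 2 := by positivity
  set m : ℝ := (∫ y in angleCell, g y) / (2 * Real.pi) ^ 2 with hm
  have hmA : m * (2 * Real.pi) ^ 2 = ∫ y in angleCell, g y := div_mul_cancel₀ _ hA.ne'
  have hc : IntegrableOn (fun _ : ℝ × ℝ => m ^ 2) angleCell :=
    integrableOn_const volume_angleCell_lt_top.ne
  have hnn : 0 ≤ ∫ y in angleCell, (g y ^ 2 - 2 * m * g y + m ^ 2) :=
    integral_nonneg fun y => by
      have := sq_nonneg (g y - m)
      simp only [Pi.zero_apply]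
      nlinarith
  have e : ∫ y in angleCell, (g y ^ 2 - 2 * m * g y + m ^ 2) =
      (∫ y in angleCell, g y ^ 2) - 2 * m * (∫ y in angleCell, g y) + (2 * Real.pi) ^ 2 * m ^ 2 := by
    have h12 : IntegrableOn (fun y => g y ^ 2 - 2 * m * g y) angleCell := h2.sub (h1.const_mul _)
    rw [integral_add h12 hc, integral_sub h2 (h1.const_mul (2 * m)),
      integral_const_mul, setIntegral_const, volume_real_angleCell, smul_eq_mul]
  rw [e, ← hmA] at hnn
  rw [← hmA]
  nlinarith

/-- An exact form `dβ` on a punctured solid torus has integral zero if it is integrable, `β`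
vanishes near the boundary torus and the coefficient of `dθ ∧ dt` in `β` is square integrable for
the weight `1 / r`: a nonzero flux through the tubes `r = ρ`, `ρ → 0`, would force `1 / r` to be
integrable near `0`. -/
theorem setIntegral_divTwo_eq_zero (hr₀ : 0 < r₀)
    (hβ : ∀ u v, ContDiffOn ℝ 1 (fun x => β x u v) (region r₀))
    (hθ : ∀ x ∈ region r₀, β (x + (2 * Real.pi) • eθ) = β x)
    (ht : ∀ x ∈ region r₀, β (x + (2 * Real.pi) • et) = β x) {r₁ : ℝ} (hr₁ : r₁ < r₀)
    (hzero : ∀ x ∈ region r₀, r₁ ≤ x.1 → β x = 0)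
    (hint : IntegrableOn (divTwo β) (cell r₀))
    (hsq : IntegrableOn (fun x => β x eθ et ^ 2 / x.1) (cell r₀)) :
    ∫ x in cell r₀, divTwo β x = 0 := by
  obtain ⟨b, hb1, hb0, hb⟩ : ∃ b, r₁ ≤ b ∧ 0 < b ∧ b < r₀ :=
    ⟨max r₁ (r₀ / 2), le_max_left _ _, lt_of_lt_of_le (by linarith) (le_max_right _ _),
      max_lt hr₁ (by linarith)⟩
  rw [IntegrableOn, cell_eq, volume_restrict_prod] at hint hsq
  set p : ℝ → ℝ := fun r => ∫ y in angleCell, divTwo β (r, y) with hp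
  set q : ℝ → ℝ := fun r => ∫ y in angleCell, β (r, y) eθ et with hq
  have hpint : IntegrableOn p (Ioo 0 r₀) := hint.integral_prod_left
  have hcont := continuousOn_divTwo hβ
  -- the form `β`, hence `dβ`, vanishes for `r > b`
  have hp0 : ∀ r ∈ Ioo b r₀, p r = 0 := fun r hr => by
    refine integral_eq_zero_of_ae (Eventually.of_forall fun y => ?_)
    have hev : ∀ᶠ z : Coord in 𝓝 (r, y), b < z.1 ∧ z ∈ region r₀ :=
      (continuousAt_fst.eventually (lt_mem_nhds hr.1)).and
        ((isOpen_region r₀).mem_nhds ⟨hb0.trans hr.1, hr.2⟩)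
    have h0 : ∀ u v, fderiv ℝ (fun z => β z u v) (r, y) = 0 := fun u v => by
      have : (fun z => β z u v) =ᶠ[𝓝 (r, y)] fun _ => (0 : ℝ) := by
        filter_upwards [hev] with z hz
        rw [hzero z hz.2 (hb1.trans hz.1.le)]
        rfl
      rw [this.fderiv_eq]
      simp
    simp [divTwo, h0]
  have hI1 : IntegrableOn p (Ioc 0 b) := hpint.mono_set fun r hr => ⟨hr.1, hr.2.trans_lt hb⟩
  have hL : ∫ x in cell r₀, divTwo β x = ∫ r in (0 : ℝ)..b, p r := by
    rw [cell_eq, volume_restrict_prod, integral_prod _ hint,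
      intervalIntegral.integral_of_le hb0.le, ← Ioc_union_Ioo_eq_Ioo hb0.le hb,
      setIntegral_union (by
        rw [Set.disjoint_left]
        exact fun r h h' => absurd h.2 (not_le.2 h'.1)) measurableSet_Ioo hI1
        (hpint.mono_set fun r hr => ⟨hb0.trans hr.1, hr.2⟩),
      setIntegral_eq_zero_of_forall_eq_zero (t := Ioo b r₀) hp0, add_zero]
  have hflux : ∀ ρ ∈ Ioo 0 b, ∫ r in ρ..b, p r = -q ρ := fun ρ hρ => by
    rw [hp, setIntegral_divTwo_shell hβ hθ ht hρ.1 hρ.2.le hb, hq, ← integral_neg]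
    refine integral_congr_ae (Eventually.of_forall fun y => ?_)
    simp [hzero (b, y) ⟨hb0, hb⟩ hb1]
  rw [hL]
  by_contra hne
  set L := ∫ r in (0 : ℝ)..b, p r with hLdef
  -- the flux tends to `-L`
  have hlim : Tendsto q (𝓝[>] 0) (𝓝 (-L)) := by
    have hii : IntervalIntegrable p volume b 0 :=
      ((intervalIntegrable_iff_integrableOn_Ioc_of_le hb0.le).2 hI1).symm
    have hc : ContinuousWithinAt (fun ρ => ∫ r in b..ρ, p r) (Icc 0 b) 0 := by
      have := intervalIntegral.continuousOn_primitive_interval' hii (a := b) left_mem_uIcc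
      rw [uIcc_of_ge hb0.le] at this
      exact this 0 ⟨le_rfl, hb0.le⟩
    have hc2 : Tendsto (fun ρ => ∫ r in b..ρ, p r) (𝓝[>] 0) (𝓝 (-L)) := by
      rw [hLdef, ← intervalIntegral.integral_symm]
      refine hc.mono_left ?_
      rw [← nhdsWithin_Ioo_eq_nhdsGT hb0]
      exact nhdsWithin_mono _ Ioo_subset_Icc_self
    refine hc2.congr' ?_
    filter_upwards [Ioo_mem_nhdsGT hb0] with ρ hρ
    rw [intervalIntegral.integral_symm, hflux ρ hρ, neg_neg]
  have hsmall : ∀ᶠ ρ in 𝓝[>] (0 : ℝ), L ^ 2 / 2 < q ρ ^ 2 := by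
    have := (hlim.pow 2).eventually (lt_mem_nhds (show L ^ 2 / 2 < (-L) ^ 2 by
      have : 0 < L ^ 2 := by positivity
      rw [neg_sq]
      linarith))
    exact this
  obtain ⟨δ, hδ, hδq⟩ := (mem_nhdsGT_iff_exists_Ioo_subset' hb0).1 hsmall
  have hδ0 : (0 : ℝ) < δ := hδ
  set e := min (δ / 2) b with he
  have he0 : 0 < e := lt_min (by linarith) hb0
  have hgint : IntegrableOn (fun r => ∫ y in angleCell, β (r, y) eθ et ^ 2 / r) (Ioo 0 r₀) :=
    hsq.integral_prod_left
  have hbound : ∀ r ∈ Ioc 0 e, ‖r⁻¹‖ ≤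
      ‖(2 * (2 * Real.pi) ^ 2 / L ^ 2) * ∫ y in angleCell, β (r, y) eθ et ^ 2 / r‖ := fun r hr => by
    have hr' : r ∈ Ioo 0 r₀ := ⟨hr.1, hr.2.trans_lt ((min_le_right _ _).trans_lt hb)⟩
    have hr0 := hr.1
    have hrδ : r ∈ Ioo 0 δ := ⟨hr.1, hr.2.trans_lt ((min_le_left _ _).trans_lt (by linarith))⟩
    have h1 : L ^ 2 / 2 < q r ^ 2 := hδq hrδ
    have h2 := sq_integral_angleCell_le
      (integrableOn_slice_of_continuousOn_region (hβ eθ et).continuousOn hr')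
      (integrableOn_slice_of_continuousOn_region (G := fun x => β x eθ et ^ 2)
        ((hβ eθ et).continuousOn.pow 2) hr')
    have h3 : 0 < L ^ 2 := by positivity
    rw [integral_div]
    set Q := ∫ y in angleCell, β (r, y) eθ et ^ 2
    have h4 : L ^ 2 / 2 ≤ (2 * Real.pi) ^ 2 * Q := h1.le.trans h2
    rw [Real.norm_of_nonneg (by positivity)]
    refine le_trans ?_ (le_abs_self _)
    rw [inv_eq_one_div, show 2 * (2 * Real.pi) ^ 2 / L ^ 2 * (Q / r) =
      (2 * ((2 * Real.pi) ^ 2 * Q) / L ^ 2) / r by ring]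
    refine div_le_div_of_nonneg_right ?_ hr0.le
    rw [le_div_iff₀ h3]
    linarith
  have hinv : IntegrableOn (fun r : ℝ => r⁻¹) (Ioc 0 e) := by
    refine Integrable.mono ((hgint.mono_set fun r hr => ⟨hr.1, hr.2.trans_lt
      ((min_le_right _ _).trans_lt hb)⟩).const_mul (2 * (2 * Real.pi) ^ 2 / L ^ 2))
      measurable_inv.aestronglyMeasurable ?_
    exact (ae_restrict_iff' measurableSet_Ioc).2 (Eventually.of_forall hbound)
  have := intervalIntegrable_inv_iff.1 ((intervalIntegrable_iff_integrableOn_Ioc_of_le he0.le).2 hinv)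
  rcases this with h | h
  · exact he0.ne h
  · exact h left_mem_uIcc

/-! ### The first variation formula -/

theorem reebMap_add_eθ (r₀ : ℝ) (c : Bool) (x : Coord) :
    reebMap r₀ c (x + (2 * Real.pi) • eθ) = reebMap r₀ c x := by
  have h : Complex.exp (((x.2.1 + 2 * Real.pi : ℝ) : ℂ) * Complex.I) =
      Complex.exp (x.2.1 * Complex.I) := by
    push_cast
    rw [add_mul, Complex.exp_add, Complex.exp_two_pi_mul_I, mul_one]
  simp only [reebMap, eθ, Prod.fst_add, Prod.snd_add, Prod.smul_mk, smul_eq_mul, mul_zero, mul_one,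
    add_zero, h]

theorem reebMap_add_et (r₀ : ℝ) (c : Bool) (x : Coord) :
    reebMap r₀ c (x + (2 * Real.pi) • et) = reebMap r₀ c x := by
  have h : Complex.exp (((x.2.2 + 2 * Real.pi : ℝ) : ℂ) * Complex.I) =
      Complex.exp (x.2.2 * Complex.I) := by
    push_cast
    rw [add_mul, Complex.exp_add, Complex.exp_two_pi_mul_I, mul_one]
  simp only [reebMap, et, Prod.fst_add, Prod.snd_add, Prod.smul_mk, smul_eq_mul, mul_zero, mul_one,
    add_zero, h]

theorem fderiv_add_eq_of_region {F : Type*} [NormedAddCommGroup F] [NormedSpace ℝ F] {r₀ : ℝ}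
    {g : Coord → F} {p : Coord} (h : ∀ x ∈ region r₀, g (x + p) = g x) {x : Coord}
    (hx : x ∈ region r₀) : fderiv ℝ g (x + p) = fderiv ℝ g x := by
  rw [← fderiv_comp_add_right]
  refine Filter.EventuallyEq.fderiv_eq ?_
  filter_upwards [(isOpen_region r₀).mem_nhds hx] with y hy
  exact h y hy

namespace Variation

variable {k : ℕ∞} {r₀ : ℝ} {f : ℝ → ℝ} {V : Variation k r₀ f} {c : Bool} {s : ℝ} {x p : Coord}

/-- A translation of the angles under which the parametrization of the sphere is invariant. -/
structure IsPeriod (r₀ : ℝ) (p : Coord) : Prop where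
  fst_eq : p.1 = 0
  reebMap_add : ∀ c x, reebMap r₀ c (x + p) = reebMap r₀ c x

theorem isPeriod_eθ (r₀ : ℝ) : IsPeriod r₀ ((2 * Real.pi) • eθ) :=
  ⟨by simp [eθ], reebMap_add_eθ r₀⟩

theorem isPeriod_et (r₀ : ℝ) : IsPeriod r₀ ((2 * Real.pi) • et) :=
  ⟨by simp [et], reebMap_add_et r₀⟩

theorem IsPeriod.add_mem (hp : IsPeriod r₀ p) (hx : x ∈ region r₀) : x + p ∈ region r₀ := by
  simpa [region, hp.fst_eq] using hx

theorem ω_add (hp : IsPeriod r₀ p) (hs : s ∈ Ioo (-V.ε) V.ε) (hx : x ∈ region r₀) :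
    V.ω c s (x + p) = V.ω c s x :=
  V.ω_descends c s hs _ (hp.add_mem hx) _ hx (hp.reebMap_add c x)

theorem T_add (hp : IsPeriod r₀ p) (hs : s ∈ Ioo (-V.ε) V.ε) (hx : x ∈ region r₀) :
    V.T c s (x + p) = V.T c s x :=
  V.T_descends c s hs _ (hp.add_mem hx) _ hx (hp.reebMap_add c x)

theorem η_add (hk : 3 ≤ k) (hp : IsPeriod r₀ p) (hs : s ∈ Ioo (-V.ε) V.ε) (hx : x ∈ region r₀) :
    V.η c s (x + p) = V.η c s x := by
  rw [η_eq hk hs hx, η_eq hk hs (hp.add_mem hx), T_add hp hs hx,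
    fderiv_add_eq_of_region (fun y hy => ω_add hp hs hy) hx]

theorem iotaDη_add (hk : 3 ≤ k) (hp : IsPeriod r₀ p) (hx : x ∈ region r₀) :
    V.iotaDη c (x + p) = V.iotaDη c x := by
  rw [iotaDη, iotaDη, contract_dForm (differentiableAt_η hk V.zero_mem hx),
    contract_dForm (differentiableAt_η hk V.zero_mem (hp.add_mem hx)), T_add hp V.zero_mem hx,
    fderiv_add_eq_of_region (fun y hy => η_add hk hp V.zero_mem hy) hx]

theorem ωDot_add (hp : IsPeriod r₀ p) (hx : x ∈ region r₀) : V.ωDot c (x + p) = V.ωDot c x := by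
  refine Filter.EventuallyEq.deriv_eq ?_
  filter_upwards [isOpen_Ioo.mem_nhds V.zero_mem] with s hs
  exact ω_add hp hs hx

theorem ηDot_add (hk : 3 ≤ k) (hp : IsPeriod r₀ p) (hx : x ∈ region r₀) :
    V.ηDot c (x + p) = V.ηDot c x := by
  refine Filter.EventuallyEq.deriv_eq ?_
  filter_upwards [isOpen_Ioo.mem_nhds V.zero_mem] with s hs
  exact η_add hk hp hs hx

theorem gvBoundary_eq (c : Bool) (x u v : Coord) : V.gvBoundary c x u v =
    wedge (V.η c 0 x) (V.ηDot c x) u v + 2 * wedge (V.ωDot c x) (V.iotaDη c x) u v := rfl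

theorem gvBoundary_add (hk : 3 ≤ k) (hp : IsPeriod r₀ p) (hx : x ∈ region r₀) :
    V.gvBoundary c (x + p) = V.gvBoundary c x := by
  ext u v
  rw [gvBoundary_eq, gvBoundary_eq, η_add hk hp V.zero_mem hx, ηDot_add hk hp hx, ωDot_add hp hx,
    iotaDη_add hk hp hx]

theorem intBoundary_add (hp : IsPeriod r₀ p) (hx : x ∈ region r₀) :
    V.intBoundary c (x + p) = V.intBoundary c x := by
  ext u v
  rw [intBoundary, intBoundary, ω_add hp V.zero_mem hx, ωDot_add hp hx]

theorem exists_dot_eq_zero (hk : 3 ≤ k) (V : Variation k r₀ f) :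
    ∃ r₁ < r₀, ∀ c, ∀ x ∈ region r₀, r₁ ≤ x.1 → V.ωDot c x = 0 ∧ V.ηDot c x = 0 := by
  obtain ⟨r₁, hr₁, h⟩ := V.constant_near_torus
  obtain ⟨r₂, h12, hr₂⟩ := exists_between hr₁
  refine ⟨r₂, hr₂, fun c x hx hxr => ⟨?_, ?_⟩⟩
  · have e : (fun s => V.ω c s x) =ᶠ[𝓝 0] fun _ => reebForm r₀ f c x := by
      filter_upwards [isOpen_Ioo.mem_nhds V.zero_mem] with s hs
      exact (h c s hs x hx (h12.le.trans hxr)).1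
    rw [ωDot, e.deriv_eq, deriv_const]
  · have e : (fun s => V.η c s x) =ᶠ[𝓝 0] fun _ =>
        skew (fderiv ℝ (reebForm r₀ f c) x) (reebField r₀ f c x) := by
      filter_upwards [isOpen_Ioo.mem_nhds V.zero_mem] with s hs
      have e2 : V.ω c s =ᶠ[𝓝 x] reebForm r₀ f c := by
        filter_upwards [(isOpen_region r₀).mem_nhds hx,
          continuousAt_fst.eventually (lt_mem_nhds (h12.trans_le hxr))] with y hy hy1
        exact (h c s hs y hy hy1.le).1
      rw [η_eq hk hs hx, e2.fderiv_eq, (h c s hs x hx (h12.le.trans hxr)).2]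
    rw [ηDot, e.deriv_eq, deriv_const]

/-- On a set of finite volume `L^p` is contained in `L²`, and `(r⁻¹ B(∂_θ, ∂_t))²` is one of the
terms of `‖B‖²`. -/
theorem integrableOn_sq_div {B : Coord → Coord → Coord → ℝ}
    (hB : ContinuousOn (fun x => B x eθ et) (region r₀))
    (hsmul : ∀ x a u v, B x (a • u) v = a * B x u v) {p : ℝ} (hp : 2 ≤ p)
    (h : IntegrableOn (fun x => normTwo x (B x) ^ p * x.1) (cell r₀)) :
    IntegrableOn (fun x => B x eθ et ^ 2 / x.1) (cell r₀) := by
  have hx1 : IntegrableOn (fun x : Coord => x.1) (cell r₀) := by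
    have hc : Continuous fun x : Coord => x.1 := continuous_fst
    refine (hc.continuousOn.integrableOn_compact (isCompact_Icc.prod
      (isCompact_Icc.prod isCompact_Icc))).mono_set (t := Icc 0 r₀ ×ˢ
        (Icc 0 (2 * Real.pi) ×ˢ Icc 0 (2 * Real.pi))) ?_
    exact prod_mono Ioo_subset_Icc_self (prod_mono Ioc_subset_Icc_self Ioc_subset_Icc_self)
  have hdom := hx1.add h
  refine Integrable.mono hdom ?_ ?_
  · refine ContinuousOn.aestronglyMeasurable ?_ (measurableSet_cell r₀)
    exact ((hB.pow 2).div continuousOn_fst fun x hx => hx.1.ne').mono (cell_subset_region r₀)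
  · refine (ae_restrict_iff' (measurableSet_cell r₀)).2 (Eventually.of_forall fun x hx => ?_)
    have hx0 : 0 < x.1 := hx.1.1
    set N := normTwo x (B x) with hN
    have hN0 : 0 ≤ N := Real.sqrt_nonneg _
    have hsq : (B x eθ et / x.1) ^ 2 ≤ N ^ 2 := by
      rw [hN, normTwo, Real.sq_sqrt (by positivity), hsmul, inv_mul_eq_div]
      nlinarith [sq_nonneg (B x er (x.1⁻¹ • eθ)), sq_nonneg (B x er et)]
    have hNp : N ^ 2 ≤ 1 + N ^ p := by
      rcases le_total N 1 with h1 | h1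
      · have : 0 ≤ N ^ p := Real.rpow_nonneg hN0 p
        nlinarith
      · have := Real.rpow_le_rpow_of_exponent_le h1 hp
        rw [Real.rpow_two] at this
        linarith
    have hNp0 : 0 ≤ N ^ p := Real.rpow_nonneg hN0 p
    rw [Real.norm_of_nonneg (by positivity), Pi.add_apply,
      Real.norm_of_nonneg (by positivity)]
    have e : B x eθ et ^ 2 / x.1 = (B x eθ et / x.1) ^ 2 * x.1 := by
      field_simp
    rw [e, show x.1 + N ^ p * x.1 = (1 + N ^ p) * x.1 by ring]
    exact mul_le_mul_of_nonneg_right (hsq.trans hNp) hx0.le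

theorem wedge_smul_left (α β : Coord →L[ℝ] ℝ) (a : ℝ) (u v : Coord) :
    wedge α β (a • u) v = a * wedge α β u v := by
  simp only [wedge, map_smul, smul_eq_mul]
  ring

theorem integrableOn_gvBoundary_sq (hk : 3 ≤ k) (hV : V.Admissible) (c : Bool) :
    IntegrableOn (fun x => V.gvBoundary c x eθ et ^ 2 / x.1) (cell r₀) := by
  obtain ⟨-, p, hp, h⟩ := hV
  refine integrableOn_sq_div (V.contDiffOn_gvBoundary hk c eθ et).continuousOn
    (fun x a u v => ?_) hp (h c)
  rw [gvBoundary_eq, gvBoundary_eq, wedge_smul_left, wedge_smul_left]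
  ring

theorem integrableOn_intBoundary_sq (hk : 3 ≤ k) (hV : V.Constrained) (c : Bool) :
    IntegrableOn (fun x => V.intBoundary c x eθ et ^ 2 / x.1) (cell r₀) := by
  obtain ⟨-, -, p, hp, h⟩ := hV
  exact integrableOn_sq_div (V.contDiffOn_intBoundary hk c eθ et).continuousOn
    (fun x a u v => wedge_smul_left _ _ _ _ _) hp (h c)

/-- Differentiation under the integral sign. -/
theorem Dominated.hasDerivAt_integral {q : Bool → ℝ → Coord → ℝ} (hq : V.Dominated q)
    (hC : ∀ c, ContDiffOn ℝ 1 (fun y : ℝ × Coord => q c y.1 y.2)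
      (Ioo (-V.ε) V.ε ×ˢ region r₀)) (h0 : ∀ c, ∀ x ∈ region r₀, q c 0 x = 0) (c : Bool) :
    IntegrableOn (fun x => deriv (fun s => q c s x) 0) (cell r₀) ∧
      HasDerivAt (fun s => ∫ x in cell r₀, q c s x)
        (∫ x in cell r₀, deriv (fun s => q c s x) 0) 0 := by
  obtain ⟨b, hb, hle⟩ := hq c
  have hI : Ioo (-V.ε) V.ε ∈ 𝓝 (0 : ℝ) := isOpen_Ioo.mem_nhds V.zero_mem
  have hR := isOpen_region r₀
  refine hasDerivAt_integral_of_dominated_loc_of_deriv_le (bound := b)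
    (F := fun s x => q c s x) (F' := fun s x => deriv (fun σ => q c σ x) s) hI ?_ ?_ ?_ ?_ hb ?_
  · filter_upwards [hI] with s hs
    exact ((contDiffOn_slice (hC c) hs).continuousOn.mono
      (cell_subset_region r₀)).aestronglyMeasurable (measurableSet_cell r₀)
  · exact (integrable_zero _ _ _).congr ((ae_restrict_iff' (measurableSet_cell r₀)).2
      (Eventually.of_forall fun x hx => (h0 c x (cell_subset_region r₀ hx)).symm))
  · exact ((contDiffOn_slice (G := fun s x => deriv (fun σ => q c σ x) s)
      (contDiffOn_deriv_slice (m := 0) isOpen_Ioo hR (hC c) (by norm_num))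
      V.zero_mem).continuousOn.mono (cell_subset_region r₀)).aestronglyMeasurable
      (measurableSet_cell r₀)
  · refine (ae_restrict_iff' (measurableSet_cell r₀)).2 (Eventually.of_forall fun x hx s hs => ?_)
    exact hle s hs x hx
  · refine (ae_restrict_iff' (measurableSet_cell r₀)).2 (Eventually.of_forall fun x hx s hs => ?_)
    exact (hasDerivAt_slice (differentiableAt_joint isOpen_Ioo hR (hC c) le_rfl hs
      (cell_subset_region r₀ hx))).differentiableAt.hasDerivAt

theorem hasDerivAt_gv (hk : 3 ≤ k) (hf : ContDiffOn ℝ 4 f (Ico 0 r₀)) (hV : V.Admissible) :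
    (∀ c, IntegrableOn (fun x => deriv (fun s => V.gvDensity c s x) 0) (cell r₀)) ∧
      HasDerivAt V.gv (∑ c, ∫ x in cell r₀, deriv (fun s => V.gvDensity c s x) 0) 0 := by
  have h := hV.1.hasDerivAt_integral (V.contDiffOn_gvDensity hk)
    fun c x hx => gvDensity_zero hk hf hx
  exact ⟨fun c => (h c).1, HasDerivAt.fun_sum fun c _ => (h c).2⟩

theorem hasDerivAt_intAverage (hk : 3 ≤ k) (hf : ContDiffOn ℝ 4 f (Ico 0 r₀))
    (hV : V.Dominated V.intDensity) :
    (∀ c, IntegrableOn (fun x => deriv (fun s => V.intDensity c s x) 0) (cell r₀)) ∧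
      HasDerivAt V.intAverage (∑ c, ∫ x in cell r₀, deriv (fun s => V.intDensity c s x) 0) 0 := by
  have h := hV.hasDerivAt_integral (V.contDiffOn_intDensity hk)
    fun c x hx => intDensity_zero hk hf hx
  exact ⟨fun c => (h c).1, HasDerivAt.fun_sum fun c _ => (h c).2⟩

/-- The exact terms do not contribute to the first variation of an admissible variation. -/
theorem setIntegral_divTwo_gvBoundary (hr₀ : 0 < r₀) (hk : 3 ≤ k) (hV : V.Admissible) (c : Bool)
    (hint : IntegrableOn (divTwo (V.gvBoundary c)) (cell r₀)) :
    ∫ x in cell r₀, divTwo (V.gvBoundary c) x = 0 := by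
  obtain ⟨r₁, hr₁, h⟩ := exists_dot_eq_zero hk V
  refine setIntegral_divTwo_eq_zero hr₀ (V.contDiffOn_gvBoundary hk c)
    (fun x hx => gvBoundary_add hk (isPeriod_eθ r₀) hx)
    (fun x hx => gvBoundary_add hk (isPeriod_et r₀) hx) hr₁ (fun x hx hxr => ?_) hint
    (integrableOn_gvBoundary_sq hk hV c)
  ext u v
  rw [gvBoundary_eq, (h c x hx hxr).1, (h c x hx hxr).2]
  simp [wedge]

/-- The first variation of `gv` at the Reeb pair is `∓ 2 ∫ ω̇(∂_θ) (h' sin μ)'`. -/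
theorem hasDerivAt_gv_reeb (hr₀ : 0 < r₀) (hk : 3 ≤ k) (hf : ContDiffOn ℝ 4 f (Ico 0 r₀))
    (hV : V.Admissible)
    (hE : ∀ c, IntegrableOn (fun x => V.ωDot c x eθ * gvEuler r₀ f x.1) (cell r₀)) :
    HasDerivAt V.gv (∑ c, -(2 * reebSign c *
      ∫ x in cell r₀, V.ωDot c x eθ * gvEuler r₀ f x.1)) 0 := by
  obtain ⟨hint, hd⟩ := hasDerivAt_gv hk hf hV
  refine hd.congr_deriv (Finset.sum_congr rfl fun c _ => ?_)
  have hE' := (hE c).const_mul (2 * reebSign c)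
  have e : EqOn (divTwo (V.gvBoundary c)) (fun x =>
      -(2 * reebSign c * (V.ωDot c x eθ * gvEuler r₀ f x.1))
        - deriv (fun s => V.gvDensity c s x) 0) (cell r₀) := fun x hx => by
    simp only [(hasDerivAt_gvDensity_reeb (V := V) (c := c) hk hf (cell_subset_region r₀ hx)).deriv]
    ring
  have hdiv := setIntegral_divTwo_gvBoundary hr₀ hk hV c
    ((hE'.neg.sub (hint c)).congr ((ae_restrict_iff' (measurableSet_cell r₀)).2
      (Eventually.of_forall fun x hx => (e hx).symm)))
  rw [setIntegral_congr_fun (measurableSet_cell r₀) e] at hdiv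
  have h2 : ∫ x in cell r₀, (-(2 * reebSign c * (V.ωDot c x eθ * gvEuler r₀ f x.1))
      - deriv (fun s => V.gvDensity c s x) 0) =
      -(2 * reebSign c * ∫ x in cell r₀, V.ωDot c x eθ * gvEuler r₀ f x.1)
        - ∫ x in cell r₀, deriv (fun s => V.gvDensity c s x) 0 := by
    have hneg : IntegrableOn (fun x =>
        -(2 * reebSign c * (V.ωDot c x eθ * gvEuler r₀ f x.1))) (cell r₀) := hE'.neg
    rw [integral_sub hneg (hint c), integral_neg, integral_const_mul]
  linarith

/-- If the Euler–Lagrange expressions of `gv` and of `∫ ω ∧ dω` are proportional, the first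
variation of `gv` is proportional to the one of `∫ ω ∧ dω`, which vanishes under the constraint. -/
theorem hasDerivAt_gv_of_constrained (hr₀ : 0 < r₀) (hk : 3 ≤ k)
    (hf : ContDiffOn ℝ 4 f (Ico 0 r₀)) (hV : V.Admissible) (hV' : V.Constrained) {lam : ℝ}
    (hE : ∀ r ∈ Ioo 0 r₀, gvEuler r₀ f r = lam * intEuler r₀ f r) :
    HasDerivAt V.gv 0 0 := by
  obtain ⟨hint, hd⟩ := hasDerivAt_gv hk hf hV
  obtain ⟨hint', hd'⟩ := hasDerivAt_intAverage hk hf hV'.2.1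
  obtain ⟨r₁, hr₁, h⟩ := exists_dot_eq_zero hk V
  have hzero : ∑ c, ∫ x in cell r₀, deriv (fun s => V.intDensity c s x) 0 = 0 := by
    refine hd'.unique ((hasDerivAt_const 0 (0 : ℝ)).congr_of_eventuallyEq ?_)
    filter_upwards [isOpen_Ioo.mem_nhds V.zero_mem] with s hs
    exact hV'.1 s hs
  have key : ∀ c, (∫ x in cell r₀, deriv (fun s => V.gvDensity c s x) 0)
      + lam * ∫ x in cell r₀, deriv (fun s => V.intDensity c s x) 0 = 0 := fun c => by
    set β : Coord → Coord → Coord → ℝ := fun x u v =>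
      V.gvBoundary c x u v + lam * V.intBoundary c x u v with hβ
    have hC : ∀ u v, ContDiffOn ℝ 1 (fun x => β x u v) (region r₀) := fun u v =>
      (V.contDiffOn_gvBoundary hk c u v).add
        (contDiffOn_const.mul (V.contDiffOn_intBoundary hk c u v))
    have e : EqOn (divTwo β) (fun x => -(deriv (fun s => V.gvDensity c s x) 0
        + lam * deriv (fun s => V.intDensity c s x) 0)) (cell r₀) := fun x hx => by
      have hx' := cell_subset_region r₀ hx
      simp only [hβ]
      rw [divTwo_add_mul lam
        (fun u v => differentiableAt_of_region (V.contDiffOn_gvBoundary hk c u v) hx')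
        (fun u v => differentiableAt_of_region (V.contDiffOn_intBoundary hk c u v) hx'),
        (hasDerivAt_gvDensity_reeb (V := V) (c := c) hk hf hx').deriv,
        (hasDerivAt_intDensity_reeb (V := V) (c := c) hk hf hx').deriv, hE x.1 hx']
      ring
    have hi := (hint c).add ((hint' c).const_mul lam)
    have hsq : IntegrableOn (fun x => β x eθ et ^ 2 / x.1) (cell r₀) := by
      refine Integrable.mono (((integrableOn_gvBoundary_sq hk hV c).const_mul 2).add
        ((integrableOn_intBoundary_sq hk hV' c).const_mul (2 * lam ^ 2))) ?_ ?_
      · exact ((((hC eθ et).continuousOn.pow 2).div continuousOn_fst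
          fun x hx => hx.1.ne').mono (cell_subset_region r₀)).aestronglyMeasurable
          (measurableSet_cell r₀)
      · refine (ae_restrict_iff' (measurableSet_cell r₀)).2 (Eventually.of_forall fun x hx => ?_)
        have hx0 : 0 < x.1 := hx.1.1
        rw [Pi.add_apply, Real.norm_of_nonneg (by positivity), Real.norm_of_nonneg (by positivity),
          ← mul_div_assoc, ← mul_div_assoc, ← add_div]
        refine div_le_div_of_nonneg_right ?_ hx0.le
        simp only [hβ]
        nlinarith [sq_nonneg (V.gvBoundary c x eθ et - lam * V.intBoundary c x eθ et)]
    have hz := setIntegral_divTwo_eq_zero hr₀ hC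
      (fun x hx => by
        simp only [hβ, gvBoundary_add hk (isPeriod_eθ r₀) hx, intBoundary_add (isPeriod_eθ r₀) hx])
      (fun x hx => by
        simp only [hβ, gvBoundary_add hk (isPeriod_et r₀) hx, intBoundary_add (isPeriod_et r₀) hx])
      hr₁ (fun x hx hxr => by
        ext u v
        simp [hβ, gvBoundary_eq, intBoundary, (h c x hx hxr).1, (h c x hx hxr).2, wedge])
      (hi.neg.congr ((ae_restrict_iff' (measurableSet_cell r₀)).2
        (Eventually.of_forall fun x hx => (e hx).symm))) hsq
    rw [setIntegral_congr_fun (measurableSet_cell r₀) e, integral_neg,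
      integral_add (hint c) ((hint' c).const_mul lam), integral_const_mul] at hz
    linarith
  refine hd.congr_deriv ?_
  have := Finset.sum_congr rfl fun c (_ : c ∈ (Finset.univ : Finset Bool)) => key c
  rw [Finset.sum_add_distrib, ← Finset.mul_sum, hzero] at this
  simpa using this

end Variation
/-! ### Regularity of the radial coefficients -/

section Regularity

variable {r₀ : ℝ} {f : ℝ → ℝ} {r : ℝ}

theorem continuousOn_reebAngle (hf : ContDiffOn ℝ 4 f (Ico 0 r₀)) :
    ContinuousOn (reebAngle r₀ f) (Ico 0 r₀) := by
  rw [reebAngle_eq]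
  exact Real.continuous_arctan.comp_continuousOn (continuousOn_der hf (by norm_num))

theorem continuousOn_angleDeriv (hf : ContDiffOn ℝ 4 f (Ico 0 r₀)) :
    ContinuousOn (angleDeriv r₀ f) (Ico 0 r₀) :=
  (continuousOn_der hf (by norm_num)).div
    (continuousOn_const.add ((continuousOn_der hf (by norm_num)).pow 2)) fun r _ => by positivity

theorem continuousOn_gvCoeffDeriv (hf : ContDiffOn ℝ 4 f (Ico 0 r₀)) :
    ContinuousOn (gvCoeffDeriv r₀ f) (Ico 0 r₀) := by
  have h1 := continuousOn_der hf (j := 1) (by norm_num)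
  have h2 := continuousOn_der hf (j := 2) (by norm_num)
  have h3 := continuousOn_der hf (j := 3) (by norm_num)
  have e1 : ∀ r ∈ Ico 0 r₀, (1 + der r₀ f 1 r ^ 2) ^ 2 ≠ 0 := fun r _ => by positivity
  have e2 : ∀ r ∈ Ico 0 r₀, (1 + der r₀ f 1 r ^ 2) ^ 3 ≠ 0 := fun r _ => by positivity
  unfold gvCoeffDeriv
  fun_prop (disch := assumption)

theorem continuousOn_gvMomentum (hf : ContDiffOn ℝ 4 f (Ico 0 r₀)) :
    ContinuousOn (gvMomentum r₀ f) (Ico 0 r₀) :=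
  (continuousOn_gvCoeffDeriv hf).mul
    (Real.continuous_sin.comp_continuousOn (continuousOn_reebAngle hf))

theorem continuousOn_gvCoeff (hf : ContDiffOn ℝ 4 f (Ico 0 r₀)) :
    ContinuousOn (gvCoeff r₀ f) (Ico 0 r₀) :=
  (continuousOn_angleDeriv hf).mul
    ((Real.continuous_sin.comp_continuousOn (continuousOn_reebAngle hf)).pow 2)

theorem continuousOn_intEuler (hf : ContDiffOn ℝ 4 f (Ico 0 r₀)) :
    ContinuousOn (intEuler r₀ f) (Ico 0 r₀) :=
  (continuousOn_angleDeriv hf).mul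
    (Real.continuous_sin.comp_continuousOn (continuousOn_reebAngle hf))

theorem continuousOn_gvEuler (hf : ContDiffOn ℝ 4 f (Ico 0 r₀)) :
    ContinuousOn (gvEuler r₀ f) (Ico 0 r₀) := by
  have h1 := continuousOn_der hf (j := 1) (by norm_num)
  have h2 := continuousOn_der hf (j := 2) (by norm_num)
  have h3 := continuousOn_der hf (j := 3) (by norm_num)
  have h4 := continuousOn_der hf (j := 4) (by norm_num)
  have e1 : ∀ r ∈ Ico 0 r₀, (1 + der r₀ f 1 r ^ 2) ^ 2 ≠ 0 := fun r _ => by positivity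
  have e2 : ∀ r ∈ Ico 0 r₀, (1 + der r₀ f 1 r ^ 2) ^ 3 ≠ 0 := fun r _ => by positivity
  have e3 : ∀ r ∈ Ico 0 r₀, (1 + der r₀ f 1 r ^ 2) ^ 4 ≠ 0 := fun r _ => by positivity
  have h : ContinuousOn (gvCoeffDeriv₂ r₀ f) (Ico 0 r₀) := by
    unfold gvCoeffDeriv₂
    fun_prop (disch := assumption)
  have hμ := continuousOn_reebAngle hf
  exact (h.mul (Real.continuous_sin.comp_continuousOn hμ)).add
    ((continuousOn_gvCoeffDeriv hf).mul ((Real.continuous_cos.comp_continuousOn hμ).mul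
      (continuousOn_angleDeriv hf)))

theorem contDiffOn_reebAngle {n : WithTop ℕ∞} (hf : ContDiffOn ℝ (n + 1) f (Ico 0 r₀)) :
    ContDiffOn ℝ n (reebAngle r₀ f) (Ioo 0 r₀) :=
  Real.contDiff_arctan.comp_contDiffOn
    ((hf.derivWithin (uniqueDiffOn_Ico 0 r₀) le_rfl).mono Ioo_subset_Ico_self)

end Regularity

/-! ### Test variations -/

theorem reebMap_fst_injective {r₀ : ℝ} (hr₀ : 0 < r₀) {c : Bool} {x y : Coord}
    (hx : x ∈ region r₀) (hy : y ∈ region r₀) (h : reebMap r₀ c x = reebMap r₀ c y) :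
    x.1 = y.1 := by
  have hx0 : 0 < x.1 := hx.1
  have hy0 : 0 < y.1 := hy.1
  have hsx : 0 < Real.sqrt (x.1 ^ 2 + r₀ ^ 2) := Real.sqrt_pos.2 (by positivity)
  have hsy : 0 < Real.sqrt (y.1 ^ 2 + r₀ ^ 2) := Real.sqrt_pos.2 (by positivity)
  -- the coordinate whose modulus is `r₀ / √(r² + r₀²)`
  have key : r₀ / Real.sqrt (x.1 ^ 2 + r₀ ^ 2) = r₀ / Real.sqrt (y.1 ^ 2 + r₀ ^ 2) := by
    have h2 := congrArg (fun z : EuclideanSpace ℂ (Fin 2) => ‖z (if c then 1 else 0)‖) h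
    have n : ∀ s : ℝ, 0 < s → ‖((r₀ / s : ℝ) : ℂ)‖ = r₀ / s := fun s hs => by
      rw [Complex.norm_real, Real.norm_of_nonneg (by positivity)]
    cases c <;>
      simpa only [reebMap, if_true, if_false, Bool.false_eq_true, PiLp.toLp_apply,
        Matrix.cons_val_zero, Matrix.cons_val_one, norm_mul, Complex.norm_exp_ofReal_mul_I,
        mul_one, n _ hsx, n _ hsy] using h2
  have e : Real.sqrt (x.1 ^ 2 + r₀ ^ 2) = Real.sqrt (y.1 ^ 2 + r₀ ^ 2) := by
    field_simp at key
    exact key.symm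
  have e2 : x.1 ^ 2 + r₀ ^ 2 = y.1 ^ 2 + r₀ ^ 2 :=
    (Real.sqrt_inj (by positivity) (by positivity)).1 e
  exact (pow_left_inj₀ hx0.le hy0.le two_ne_zero).1 (by linarith)

/-- A smooth function with compact support in `(0, r₀)`. -/
structure IsTest (r₀ : ℝ) (φ : ℝ → ℝ) : Prop where
  contDiff : ContDiff ℝ (⊤ : ℕ∞) φ
  compact : HasCompactSupport φ
  subset : tsupport φ ⊆ Ioo 0 r₀

/-- The coefficient which restricts a variation to one of the two Reeb components. -/
def component (c : Bool) : ℝ := if c then 1 else 0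

section

variable {r₀ : ℝ} {f φ : ℝ → ℝ} {k : ℕ∞}

theorem IsTest.exists_Icc (hr₀ : 0 < r₀) (hφ : IsTest r₀ φ) :
    ∃ a b, 0 < a ∧ b < r₀ ∧ ∀ r, r ∉ Icc a b → φ r = 0 ∧ deriv φ r = 0 ∧ deriv (deriv φ) r = 0 := by
  have hsupp : ∀ r, r ∉ tsupport φ → φ r = 0 ∧ deriv φ r = 0 ∧ deriv (deriv φ) r = 0 := fun r hr =>
    ⟨image_eq_zero_of_notMem_tsupport hr,
      image_eq_zero_of_notMem_tsupport fun h => hr (tsupport_deriv_subset h),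
      image_eq_zero_of_notMem_tsupport fun h =>
        hr (tsupport_deriv_subset (tsupport_deriv_subset h))⟩
  rcases (tsupport φ).eq_empty_or_nonempty with he | hne
  · exact ⟨r₀ / 2, r₀ / 2, by linarith, by linarith, fun r _ => hsupp r (by simp [he])⟩
  · obtain ⟨a, ha⟩ := hφ.compact.isCompact.exists_isLeast hne
    obtain ⟨b, hb⟩ := hφ.compact.isCompact.exists_isGreatest hne
    exact ⟨a, b, (hφ.subset ha.1).1, (hφ.subset hb.1).2,
      fun r hr => hsupp r fun h => hr ⟨ha.2 h, hb.2 h⟩⟩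

/-- The variation `ω_s = ω + s φ(r) dθ`, `T_s = T` on the first Reeb component, constant on the
other one. -/
def testVariation (hr₀ : 0 < r₀) (hf : ContDiffOn ℝ (k + 1) f (Ico 0 r₀)) (hφ : IsTest r₀ φ) :
    Variation k r₀ f where
  ε := 1
  ε_pos := one_pos
  ω c s x := covec (-(reebSign c * Real.sin (reebAngle r₀ f x.1))) (s * (component c * φ x.1))
    (reebSign c * Real.cos (reebAngle r₀ f x.1))
  T c _ x := reebField r₀ f c x
  contDiffOn_ω c := by
    have hμ : ContDiffOn ℝ k (fun y : ℝ × Coord => reebAngle r₀ f y.2.1)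
        (Ioo (-1) 1 ×ˢ region r₀) :=
      (contDiffOn_reebAngle hf).comp (by fun_prop) fun y hy => hy.2
    have hφ' : ContDiff ℝ k φ := hφ.contDiff.of_le (WithTop.coe_le_coe.2 le_top)
    have h1 : ContDiffOn ℝ k (fun y : ℝ × Coord => φ y.2.1) (Ioo (-1) 1 ×ˢ region r₀) :=
      (hφ'.comp (by fun_prop)).contDiffOn
    have h0 : ContDiffOn ℝ k (fun y : ℝ × Coord => y.1) (Ioo (-1) 1 ×ˢ region r₀) := by fun_prop
    exact (((contDiffOn_const.mul (Real.contDiff_sin.comp_contDiffOn hμ)).neg.smul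
      contDiffOn_const).add ((h0.mul (contDiffOn_const.mul h1)).smul contDiffOn_const)).add
      ((contDiffOn_const.mul (Real.contDiff_cos.comp_contDiffOn hμ)).smul contDiffOn_const)
  contDiffOn_T c := by
    have hμ : ContDiffOn ℝ k (fun y : ℝ × Coord => reebAngle r₀ f y.2.1)
        (Ioo (-1) 1 ×ˢ region r₀) :=
      (contDiffOn_reebAngle hf).comp (by fun_prop) fun y hy => hy.2
    simp only [reebField_eq]
    exact (contDiffOn_const.mul (Real.contDiff_sin.comp_contDiffOn hμ)).neg.prodMk
      (contDiffOn_const.prodMk (contDiffOn_const.mul (Real.contDiff_cos.comp_contDiffOn hμ)))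
  ω_zero c x _ := by rw [reebForm_eq, zero_mul]
  T_zero _ _ _ := rfl
  normalized c s _ x _ := by
    rw [covec_apply, reebField_eq]
    linear_combination (reebSign_mul_self c) +
      reebSign c * reebSign c * Real.sin_sq_add_cos_sq (reebAngle r₀ f x.1)
  ω_descends c s _ x hx y hy h := by rw [reebMap_fst_injective hr₀ hx hy h]
  T_descends c s _ x hx y hy h := by
    rw [reebField_eq, reebField_eq, reebMap_fst_injective hr₀ hx hy h]
  constant_near_torus := by
    obtain ⟨a, b, -, hb, h⟩ := hφ.exists_Icc hr₀
    obtain ⟨r₁, h1, h2⟩ := exists_between hb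
    refine ⟨r₁, h2, fun c s _ x _ hxr => ⟨?_, rfl⟩⟩
    rw [(h x.1 fun hx => by linarith [hx.2]).1, mul_zero, mul_zero, reebForm_eq]

theorem integrableOn_cell_of_eq_zero {G : Coord → ℝ} (hG : ContinuousOn G (region r₀)) {a b : ℝ}
    (ha : 0 < a) (hb : b < r₀) (h0 : ∀ x ∈ region r₀, x.1 ∉ Icc a b → G x = 0) :
    IntegrableOn G (cell r₀) := by
  refine (integrableOn_of_continuousOn_region hG ha hb).of_forall_sdiff_eq_zero
    (measurableSet_cell r₀) fun x hx => h0 x (cell_subset_region r₀ hx.1) fun h => ?_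
  exact hx.2 ⟨h, hx.1.2⟩

theorem setIntegral_cell_radial {Q : ℝ → ℝ} (hQ : IntegrableOn (fun x : Coord => Q x.1) (cell r₀)) :
    ∫ x in cell r₀, Q x.1 = (2 * Real.pi) ^ 2 * ∫ r in Ioo 0 r₀, Q r := by
  rw [IntegrableOn, cell_eq, volume_restrict_prod] at hQ
  rw [cell_eq, volume_restrict_prod, integral_prod _ hQ]
  simp only [integral_const, smul_eq_mul, measureReal_restrict_apply_univ, volume_real_angleCell]
  rw [integral_const_mul]

theorem wedge_smul_right (α β : Coord →L[ℝ] ℝ) (a : ℝ) (u v : Coord) :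
    wedge α β u (a • v) = a * wedge α β u v := by
  simp only [wedge, map_smul, smul_eq_mul]
  ring

theorem integrableOn_normTwo {B : Coord → Coord → Coord → ℝ}
    (hB : ∀ u v, ContinuousOn (fun x => B x u v) (region r₀))
    (hl : ∀ x a u v, B x (a • u) v = a * B x u v) (hr : ∀ x a u v, B x u (a • v) = a * B x u v)
    {a b : ℝ} (ha : 0 < a) (hb : b < r₀) (h0 : ∀ x ∈ region r₀, x.1 ∉ Icc a b → B x = 0) :
    IntegrableOn (fun x => normTwo x (B x) ^ (2 : ℝ) * x.1) (cell r₀) := by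
  have e : ∀ x, normTwo x (B x) ^ (2 : ℝ) =
      (x.1⁻¹ * B x er eθ) ^ 2 + B x er et ^ 2 + (x.1⁻¹ * B x eθ et) ^ 2 := fun x => by
    rw [Real.rpow_two, normTwo, Real.sq_sqrt (by positivity), hl, hr]
  simp only [e]
  refine integrableOn_cell_of_eq_zero ?_ ha hb fun x hx hxr => by simp [h0 x hx hxr]
  have hinv : ContinuousOn (fun x : Coord => x.1⁻¹) (region r₀) :=
    continuousOn_fst.inv₀ fun x hx => hx.1.ne'
  exact (((((hinv.mul (hB er eθ)).pow 2).add ((hB er et).pow 2)).add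
    ((hinv.mul (hB eθ et)).pow 2)).mul continuousOn_fst)

theorem Variation.dominated_of_linear {V : Variation k r₀ f} {q : Bool → ℝ → Coord → ℝ}
    {Q : Bool → ℝ → ℝ} (hq : ∀ c, ∀ s ∈ Ioo (-V.ε) V.ε, ∀ x ∈ region r₀, q c s x = s * Q c x.1)
    (hQ : ∀ c, IntegrableOn (fun x : Coord => Q c x.1) (cell r₀)) : V.Dominated q := fun c => by
  refine ⟨fun x => |Q c x.1|, (hQ c).abs, fun s hs x hx => ?_⟩
  have e : (fun σ => q c σ x) =ᶠ[𝓝 s] fun σ => σ * Q c x.1 := by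
    filter_upwards [isOpen_Ioo.mem_nhds hs] with σ hσ
    exact hq c σ hσ x (cell_subset_region r₀ hx)
  rw [e.deriv_eq, deriv_mul_const_field]
  simp

end
section

variable {r₀ : ℝ} {f φ : ℝ → ℝ} {k : ℕ∞} {c : Bool} {s r : ℝ} {x : Coord}

theorem contDiffOn_four (hk : 3 ≤ k) (hf : ContDiffOn ℝ (k + 1) f (Ico 0 r₀)) :
    ContDiffOn ℝ 4 f (Ico 0 r₀) :=
  hf.of_le (by
    have h : ((3 : ℕ∞) : WithTop ℕ∞) + 1 ≤ (k : WithTop ℕ∞) + 1 :=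
      add_le_add_left (WithTop.coe_le_coe.2 hk) 1
    exact le_trans (by norm_num) h)

theorem IsTest.hasDerivAt (hφ : IsTest r₀ φ) (r : ℝ) : HasDerivAt φ (deriv φ r) r :=
  (hφ.contDiff.differentiable (by simp)).differentiableAt.hasDerivAt

theorem IsTest.contDiff_deriv (hφ : IsTest r₀ φ) : ContDiff ℝ (⊤ : ℕ∞) (deriv φ) :=
  (contDiff_infty_iff_deriv.1 hφ.contDiff).2

theorem IsTest.hasDerivAt_deriv (hφ : IsTest r₀ φ) (r : ℝ) :
    HasDerivAt (deriv φ) (deriv (deriv φ) r) r :=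
  (hφ.contDiff_deriv.differentiable (by simp)).differentiableAt.hasDerivAt

theorem IsTest.continuous_deriv₂ (hφ : IsTest r₀ φ) : Continuous (deriv (deriv φ)) :=
  (contDiff_infty_iff_deriv.1 hφ.contDiff_deriv).2.continuous

/-- The coefficient of `dθ` in `η̇` for the test variation. -/
def testη (r₀ : ℝ) (f φ : ℝ → ℝ) (c : Bool) (r : ℝ) : ℝ :=
  -(reebSign c * component c) * (Real.sin (reebAngle r₀ f r) * deriv φ r)

/-- The derivative of `testη`. -/
def testηDeriv (r₀ : ℝ) (f φ : ℝ → ℝ) (c : Bool) (r : ℝ) : ℝ :=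
  -(reebSign c * component c) * (Real.cos (reebAngle r₀ f r) * angleDeriv r₀ f r * deriv φ r
    + Real.sin (reebAngle r₀ f r) * deriv (deriv φ) r)

theorem hasDerivAt_testη (hf : ContDiffOn ℝ 4 f (Ico 0 r₀)) (hφ : IsTest r₀ φ) (c : Bool)
    (hr : r ∈ Ioo 0 r₀) : HasDerivAt (testη r₀ f φ c) (testηDeriv r₀ f φ c r) r :=
  (((hasDerivAt_reebAngle hf hr).sin.mul (hφ.hasDerivAt_deriv r)).const_mul _)

variable (hr₀ : 0 < r₀) (hf : ContDiffOn ℝ (k + 1) f (Ico 0 r₀)) (hφ : IsTest r₀ φ)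

theorem testVariation_skew_fderiv_ω (hk : 3 ≤ k) (hx : x ∈ region r₀) (u v : Coord) :
    skew (fderiv ℝ ((testVariation hr₀ hf hφ).ω c s) x) u v =
      u.1 * (s * (component c * deriv φ x.1) * v.2.1 - reebSign c * intEuler r₀ f x.1 * v.2.2)
      - v.1 * (s * (component c * deriv φ x.1) * u.2.1
        - reebSign c * intEuler r₀ f x.1 * u.2.2) := by
  have hμ := hasDerivAt_reebAngle (contDiffOn_four hk hf) hx
  rw [skew_fderiv_radial (α := (testVariation hr₀ hf hφ).ω c s)
    ((hμ.sin.const_mul (reebSign c)).neg)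
    (((hφ.hasDerivAt x.1).const_mul (component c)).const_mul s) (hμ.cos.const_mul (reebSign c))
    (Eventually.of_forall fun y => rfl), intEuler]
  ring

theorem testVariation_η (hk : 3 ≤ k) (hs : s ∈ Ioo (-1 : ℝ) 1) (hx : x ∈ region r₀) :
    (testVariation hr₀ hf hφ).η c s x =
      covec (intEuler r₀ f x.1 * Real.cos (reebAngle r₀ f x.1)) (s * testη r₀ f φ c x.1)
        (gvCoeff r₀ f x.1) := by
  refine ext_covec fun v => ?_
  rw [Variation.η_eq hk hs hx, testVariation_skew_fderiv_ω hr₀ hf hφ hk hx,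
    show (testVariation hr₀ hf hφ).T c s x = reebField r₀ f c x from rfl, reebField_eq, gvCoeff,
    intEuler, testη]
  linear_combination (angleDeriv r₀ f x.1 * Real.sin (reebAngle r₀ f x.1) *
    (Real.cos (reebAngle r₀ f x.1) * v.1 + Real.sin (reebAngle r₀ f x.1) * v.2.2)) *
    reebSign_mul_self c

theorem testVariation_skew_fderiv_η (hk : 3 ≤ k) (hs : s ∈ Ioo (-1 : ℝ) 1) (hx : x ∈ region r₀)
    (u v : Coord) :
    skew (fderiv ℝ ((testVariation hr₀ hf hφ).η c s) x) u v =
      u.1 * (s * testηDeriv r₀ f φ c x.1 * v.2.1 + gvCoeffDeriv r₀ f x.1 * v.2.2)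
      - v.1 * (s * testηDeriv r₀ f φ c x.1 * u.2.1 + gvCoeffDeriv r₀ f x.1 * u.2.2) := by
  have hf4 := contDiffOn_four hk hf
  have hμ := hasDerivAt_reebAngle hf4 hx
  rw [skew_fderiv_radial (((hasDerivAt_angleDeriv hf4 hx).mul hμ.sin).mul hμ.cos)
    ((hasDerivAt_testη hf4 hφ c hx).const_mul s) (hasDerivAt_gvCoeff hf4 hx) ?_]
  filter_upwards [(isOpen_region r₀).mem_nhds hx] with y hy
  exact testVariation_η hr₀ hf hφ hk hs hy

theorem testVariation_gvDensity (hk : 3 ≤ k) (hs : s ∈ Ioo (-1 : ℝ) 1) (hx : x ∈ region r₀) :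
    (testVariation hr₀ hf hφ).gvDensity c s x = s * (gvCoeff r₀ f x.1 * testηDeriv r₀ f φ c x.1
      - gvCoeffDeriv r₀ f x.1 * testη r₀ f φ c x.1) := by
  rw [Variation.gvDensity_eq hk hs hx, testVariation_η hr₀ hf hφ hk hs hx]
  simp only [wedgeBilin, testVariation_skew_fderiv_η hr₀ hf hφ hk hs hx, covec_apply, er, eθ, et]
  ring

theorem testVariation_intDensity (hk : 3 ≤ k) (hs : s ∈ Ioo (-1 : ℝ) 1) (hx : x ∈ region r₀) :
    (testVariation hr₀ hf hφ).intDensity c s x = s * (reebSign c * component c *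
      (intEuler r₀ f x.1 * φ x.1 + Real.cos (reebAngle r₀ f x.1) * deriv φ x.1)) := by
  rw [Variation.intDensity_eq hk hs hx]
  simp only [wedgeBilin, testVariation_skew_fderiv_ω hr₀ hf hφ hk hx, er, eθ, et]
  simp only [testVariation, covec_apply]
  ring

theorem testVariation_ωDot (x : Coord) :
    (testVariation hr₀ hf hφ).ωDot c x = covec 0 (component c * φ x.1) 0 := by
  have h : HasDerivAt (fun s : ℝ => covec (-(reebSign c * Real.sin (reebAngle r₀ f x.1)))
      (s * (component c * φ x.1)) (reebSign c * Real.cos (reebAngle r₀ f x.1)))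
      (covec 0 (component c * φ x.1) 0) 0 := by
    have h2 := (((hasDerivAt_id (0 : ℝ)).mul_const (component c * φ x.1)).smul_const
      ((ContinuousLinearMap.fst ℝ ℝ ℝ).comp (ContinuousLinearMap.snd ℝ ℝ (ℝ × ℝ))))
    refine (((hasDerivAt_const (0 : ℝ) _).add h2).add (hasDerivAt_const (0 : ℝ) _)).congr_deriv ?_
    simp [covec]
  exact h.deriv

theorem testVariation_ηDot (hk : 3 ≤ k) (hx : x ∈ region r₀) :
    (testVariation hr₀ hf hφ).ηDot c x = covec 0 (testη r₀ f φ c x.1) 0 := by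
  rw [Variation.ηDot_eq hk hx]
  have hT : (testVariation hr₀ hf hφ).TDot c x = 0 := deriv_const _ _
  have hω := funext (testVariation_ωDot (c := c) hr₀ hf hφ)
  rw [hT, map_zero, add_zero, hω]
  refine ext_covec fun v => ?_
  rw [skew_fderiv_radial (hasDerivAt_const _ 0) ((hφ.hasDerivAt x.1).const_mul (component c))
    (hasDerivAt_const _ 0) (Eventually.of_forall fun y => rfl),
    show (testVariation hr₀ hf hφ).T c 0 x = reebField r₀ f c x from rfl, reebField_eq, testη]
  ring

theorem integrableOn_cell_radial {Q : ℝ → ℝ} (hQ : ContinuousOn Q (Ioo 0 r₀)) {a b : ℝ}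
    (ha : 0 < a) (hb : b < r₀) (h0 : ∀ r, r ∉ Icc a b → Q r = 0) :
    IntegrableOn (fun x : Coord => Q x.1) (cell r₀) :=
  integrableOn_cell_of_eq_zero (hQ.comp continuousOn_fst fun _ hx => hx) ha hb
    fun x _ hx => h0 x.1 hx

theorem testVariation_admissible (hk : 3 ≤ k) : (testVariation hr₀ hf hφ).Admissible := by
  have hf4 := contDiffOn_four hk hf
  obtain ⟨a, b, ha, hb, h0⟩ := hφ.exists_Icc hr₀
  have hμ := (continuousOn_reebAngle hf4).mono Ioo_subset_Ico_self
  have hsin := Real.continuous_sin.comp_continuousOn hμ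
  have hcos := Real.continuous_cos.comp_continuousOn hμ
  have hφ1 : ContinuousOn (deriv φ) (Ioo 0 r₀) := hφ.contDiff_deriv.continuous.continuousOn
  have hφ2 : ContinuousOn (deriv (deriv φ)) (Ioo 0 r₀) := hφ.continuous_deriv₂.continuousOn
  have hη : ∀ r, r ∉ Icc a b → ∀ c, testη r₀ f φ c r = 0 := fun r hr c => by
    simp [testη, (h0 r hr).2.1]
  refine ⟨Variation.dominated_of_linear (Q := fun c r => gvCoeff r₀ f r * testηDeriv r₀ f φ c r
    - gvCoeffDeriv r₀ f r * testη r₀ f φ c r)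
    (fun c s hs x hx => testVariation_gvDensity hr₀ hf hφ hk hs hx) fun c => ?_,
    2, le_rfl, fun c => ?_⟩
  · refine integrableOn_cell_radial (Q := fun r => gvCoeff r₀ f r * testηDeriv r₀ f φ c r
      - gvCoeffDeriv r₀ f r * testη r₀ f φ c r) ?_ ha hb fun r hr => ?_
    · exact (((continuousOn_gvCoeff hf4).mono Ioo_subset_Ico_self).mul (continuousOn_const.mul
        (((hcos.mul ((continuousOn_angleDeriv hf4).mono Ioo_subset_Ico_self)).mul hφ1).add
          (hsin.mul hφ2)))).sub (((continuousOn_gvCoeffDeriv hf4).mono Ioo_subset_Ico_self).mul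
            (continuousOn_const.mul (hsin.mul hφ1)))
    · simp [testη, testηDeriv, (h0 r hr).2.1, (h0 r hr).2.2]
  · refine integrableOn_normTwo
      (fun u v => (Variation.contDiffOn_gvBoundary _ hk c u v).continuousOn)
      (fun x a u v => ?_) (fun x a u v => ?_) ha hb fun x hx hxr => ?_
    · simp only [Variation.gvBoundary_eq, Variation.wedge_smul_left]
      ring
    · simp only [Variation.gvBoundary_eq, wedge_smul_right]
      ring
    · ext u v
      rw [Variation.gvBoundary_eq, testVariation_ηDot hr₀ hf hφ hk hx, testVariation_ωDot,
        (h0 x.1 hxr).1, hη x.1 hxr c]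
      simp [wedge, covec_apply]

/-- The first variation of `gv` along a test variation. -/
theorem testVariation_hasDerivAt_gv (hk : 3 ≤ k) :
    HasDerivAt (testVariation hr₀ hf hφ).gv
      (-(2 * ((2 * Real.pi) ^ 2 * ∫ r in Ioo 0 r₀, φ r * gvEuler r₀ f r))) 0 := by
  have hf4 := contDiffOn_four hk hf
  obtain ⟨a, b, ha, hb, h0⟩ := hφ.exists_Icc hr₀
  have hint : IntegrableOn (fun x : Coord => φ x.1 * gvEuler r₀ f x.1) (cell r₀) :=
    integrableOn_cell_radial (Q := fun r => φ r * gvEuler r₀ f r)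
      (hφ.contDiff.continuous.continuousOn.mul ((continuousOn_gvEuler hf4).mono Ioo_subset_Ico_self)) ha hb
      fun r hr => by rw [(h0 r hr).1, zero_mul]
  have e : ∀ c, ∀ x : Coord, (testVariation hr₀ hf hφ).ωDot c x eθ * gvEuler r₀ f x.1 =
      component c * (φ x.1 * gvEuler r₀ f x.1) := fun c x => by
    rw [testVariation_ωDot, covec_apply]
    simp [eθ]
    ring
  refine (Variation.hasDerivAt_gv_reeb hr₀ hk hf4 (testVariation_admissible hr₀ hf hφ hk)
    fun c => ?_).congr_deriv ?_
  · simp only [e]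
    exact hint.const_mul _
  · simp only [e, integral_const_mul, Fintype.sum_bool]
    rw [setIntegral_cell_radial (Q := fun r => φ r * gvEuler r₀ f r) hint]
    simp [component, reebSign]

theorem integral_Ioo_deriv_eq_zero {g g' : ℝ → ℝ} (hg : ∀ r ∈ Ioo 0 r₀, HasDerivAt g (g' r) r)
    (hg' : ContinuousOn g' (Ioo 0 r₀)) {a b : ℝ} (ha : 0 < a) (hb : b < r₀)
    (h0 : ∀ r, r ∉ Icc a b → g r = 0 ∧ g' r = 0) : ∫ r in Ioo 0 r₀, g' r = 0 := by
  rcases lt_or_ge b a with hba | hab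
  · exact setIntegral_eq_zero_of_forall_eq_zero fun r _ => (h0 r fun h => by
      linarith [h.1, h.2]).2
  obtain ⟨a', ha', haa'⟩ := exists_between ha
  obtain ⟨b', hbb', hb'⟩ := exists_between hb
  have hsub : Icc a' b' ⊆ Ioo 0 r₀ := fun r hr => ⟨ha'.trans_le hr.1, hr.2.trans_lt hb'⟩
  have hle : a' ≤ b' := by linarith
  have e : ∫ r in Ioo 0 r₀, g' r = ∫ r in Ioc a' b', g' r :=
    setIntegral_eq_of_subset_of_forall_sdiff_eq_zero measurableSet_Ioo
      (Ioc_subset_Icc_self.trans hsub) fun r hr => (h0 r fun h =>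
        hr.2 ⟨haa'.trans_le h.1, h.2.trans hbb'.le⟩).2
  rw [e, ← intervalIntegral.integral_of_le hle, intervalIntegral.integral_eq_sub_of_hasDerivAt
    (f := g) (fun r hr => hg r (hsub (by rwa [uIcc_of_le hle] at hr)))
    ((hg'.mono (by rwa [uIcc_of_le hle])).intervalIntegrable),
    (h0 a' fun h => by linarith [h.1]).1, (h0 b' fun h => by linarith [h.2]).1, sub_zero]

/-- The test variation satisfies the constraint if `φ` is orthogonal to the Euler–Lagrange
expression of the constraint. -/
theorem testVariation_constrained (hk : 3 ≤ k)
    (horth : ∫ r in Ioo 0 r₀, φ r * intEuler r₀ f r = 0) :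
    (testVariation hr₀ hf hφ).Constrained := by
  have hf4 := contDiffOn_four hk hf
  obtain ⟨a, b, ha, hb, h0⟩ := hφ.exists_Icc hr₀
  have hcos := Real.continuous_cos.comp_continuousOn
    ((continuousOn_reebAngle hf4).mono Ioo_subset_Ico_self)
  have hm := (continuousOn_intEuler hf4).mono Ioo_subset_Ico_self
  have hφ0 : ContinuousOn φ (Ioo 0 r₀) := hφ.contDiff.continuous.continuousOn
  have hφ1 : ContinuousOn (deriv φ) (Ioo 0 r₀) := hφ.contDiff_deriv.continuous.continuousOn
  set Q : ℝ → ℝ := fun r => intEuler r₀ f r * φ r + Real.cos (reebAngle r₀ f r) * deriv φ r with hQ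
  have hQc : ContinuousOn Q (Ioo 0 r₀) := (hm.mul hφ0).add (hcos.mul hφ1)
  have hQ0 : ∀ r, r ∉ Icc a b → Q r = 0 := fun r hr => by simp [hQ, (h0 r hr).1, (h0 r hr).2.1]
  have hQi : IntegrableOn (fun x : Coord => Q x.1) (cell r₀) :=
    integrableOn_cell_radial hQc ha hb hQ0
  -- `Q` is the sum of the derivative of `φ cos μ` and of `2 φ μ' sin μ`
  have hQint : ∫ r in Ioo 0 r₀, Q r = 0 := by
    have hd := integral_Ioo_deriv_eq_zero (r₀ := r₀) (g := fun r => Real.cos (reebAngle r₀ f r) * φ r)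
      (g' := fun r => -intEuler r₀ f r * φ r + Real.cos (reebAngle r₀ f r) * deriv φ r)
      (fun r hr => ((hasDerivAt_reebAngle hf4 hr).cos.mul (hφ.hasDerivAt r)).congr_deriv (by
        rw [intEuler]
        ring)) ((hm.neg.mul hφ0).add (hcos.mul hφ1)) ha hb
      fun r hr => by simp [(h0 r hr).1, (h0 r hr).2.1]
    have hon : ∀ g : ℝ → ℝ, ContinuousOn g (Ioo 0 r₀) → (∀ r, r ∉ Icc a b → g r = 0) →
        IntegrableOn g (Ioo 0 r₀) := fun g hg hg0 =>
      ((hg.mono fun r hr => ⟨ha.trans_le hr.1, hr.2.trans_lt hb⟩).integrableOn_compact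
        (isCompact_Icc (a := a) (b := b))).of_forall_sdiff_eq_zero measurableSet_Ioo
        fun r hr => hg0 r hr.2
    have e : ∀ r, Q r = (-intEuler r₀ f r * φ r + Real.cos (reebAngle r₀ f r) * deriv φ r)
        + 2 * (φ r * intEuler r₀ f r) := fun r => by
      simp only [hQ]
      ring
    simp only [e]
    have i1 : IntegrableOn (fun r => -intEuler r₀ f r * φ r
        + Real.cos (reebAngle r₀ f r) * deriv φ r) (Ioo 0 r₀) :=
      hon _ ((hm.neg.mul hφ0).add (hcos.mul hφ1))
        fun r hr => by simp [(h0 r hr).1, (h0 r hr).2.1]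
    have i2 : IntegrableOn (fun r => φ r * intEuler r₀ f r) (Ioo 0 r₀) :=
      hon _ (hφ0.mul hm) fun r hr => by simp [(h0 r hr).1]
    rw [integral_add i1 (i2.const_mul 2), hd,
      integral_const_mul, horth]
    simp
  refine ⟨fun s hs => ?_, Variation.dominated_of_linear
    (Q := fun c r => reebSign c * component c * Q r)
    (fun c s hs x hx => testVariation_intDensity hr₀ hf hφ hk hs hx)
    fun c => hQi.const_mul _, 2, le_rfl, fun c => ?_⟩
  · refine Finset.sum_eq_zero fun c _ => ?_
    rw [setIntegral_congr_fun (measurableSet_cell r₀) (g := fun x : Coord =>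
      s * (reebSign c * component c * Q x.1)) fun x hx =>
        testVariation_intDensity hr₀ hf hφ hk hs (cell_subset_region r₀ hx), integral_const_mul,
      integral_const_mul, setIntegral_cell_radial hQi, hQint]
    simp
  · refine integrableOn_normTwo
      (fun u v => (Variation.contDiffOn_intBoundary _ hk c u v).continuousOn)
      (fun x a u v => Variation.wedge_smul_left _ _ _ _ _) (fun x a u v => wedge_smul_right _ _ _ _ _)
      ha hb fun x hx hxr => ?_
    ext u v
    rw [Variation.intBoundary, testVariation_ωDot, (h0 x.1 hxr).1]
    simp [wedge, covec_apply]

end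

/-! ### The Euler–Lagrange equations -/

section

variable {r₀ : ℝ} {f : ℝ → ℝ} {k : ℕ∞}

theorem eqOn_zero_of_integral_test {E : ℝ → ℝ} (hE : ContinuousOn E (Ioo 0 r₀))
    (h : ∀ φ, IsTest r₀ φ → ∫ r in Ioo 0 r₀, φ r * E r = 0) : ∀ r ∈ Ioo 0 r₀, E r = 0 := by
  have h1 : ∀ᵐ r, r ∈ Ioo 0 r₀ → E r = 0 := by
    refine isOpen_Ioo.ae_eq_zero_of_integral_contDiff_smul_eq_zero
      (hE.locallyIntegrableOn measurableSet_Ioo) fun φ hφ hc hs => ?_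
    rw [← h φ ⟨hφ, hc, hs⟩]
    simp only [smul_eq_mul]
    symm
    refine setIntegral_eq_integral_of_forall_compl_eq_zero fun r hr => ?_
    rw [image_eq_zero_of_notMem_tsupport fun h => hr (hs h), zero_mul]
  exact Measure.eqOn_open_of_ae_eq ((ae_restrict_iff' measurableSet_Ioo).2 h1) isOpen_Ioo hE
    continuousOn_const

theorem IsTest.sub_const_mul {φ χ : ℝ → ℝ} (hφ : IsTest r₀ φ) (hχ : IsTest r₀ χ) (a : ℝ) :
    IsTest r₀ (fun r => φ r - a * χ r) := by
  have h2 : tsupport (fun r => φ r - a * χ r) ⊆ tsupport φ ∪ tsupport χ := by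
    refine closure_minimal (fun r hr => ?_)
      ((isClosed_tsupport φ).union (isClosed_tsupport χ))
    by_contra hn
    rw [mem_union, not_or] at hn
    exact hr (by
      simp [image_eq_zero_of_notMem_tsupport hn.1, image_eq_zero_of_notMem_tsupport hn.2])
  exact ⟨hφ.contDiff.sub (contDiff_const.mul hχ.contDiff),
    (hφ.compact.isCompact.union hχ.compact.isCompact).of_isClosed_subset (isClosed_tsupport _) h2,
    h2.trans (union_subset hφ.subset hχ.subset)⟩

theorem IsTest.integrableOn_mul {φ E : ℝ → ℝ} (hr₀ : 0 < r₀) (hφ : IsTest r₀ φ)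
    (hE : ContinuousOn E (Ioo 0 r₀)) : IntegrableOn (fun r => φ r * E r) (Ioo 0 r₀) := by
  obtain ⟨a, b, ha, hb, h0⟩ := hφ.exists_Icc hr₀
  exact (((hφ.contDiff.continuous.continuousOn.mul hE).mono fun r hr =>
    ⟨ha.trans_le hr.1, hr.2.trans_lt hb⟩).integrableOn_compact
      (isCompact_Icc (a := a) (b := b))).of_forall_sdiff_eq_zero measurableSet_Ioo
      fun r hr => by simp [(h0 r hr.2).1]

/-- The fundamental lemma of the calculus of variations with one constraint: the Lagrange
multiplier. -/
theorem exists_multiplier (hr₀ : 0 < r₀) {E m : ℝ → ℝ} (hE : ContinuousOn E (Ioo 0 r₀))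
    (hm : ContinuousOn m (Ioo 0 r₀))
    (h : ∀ φ, IsTest r₀ φ → ∫ r in Ioo 0 r₀, φ r * m r = 0 → ∫ r in Ioo 0 r₀, φ r * E r = 0) :
    ∃ lam : ℝ, ∀ r ∈ Ioo 0 r₀, E r = lam * m r := by
  by_cases hall : ∀ φ, IsTest r₀ φ → ∫ r in Ioo 0 r₀, φ r * m r = 0
  · exact ⟨0, fun r hr => by
      rw [zero_mul, eqOn_zero_of_integral_test hE (fun φ hφ => h φ hφ (hall φ hφ)) r hr]⟩
  push Not at hall
  obtain ⟨χ, hχ, hne⟩ := hall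
  set M := ∫ r in Ioo 0 r₀, χ r * m r with hM
  set lam := (∫ r in Ioo 0 r₀, χ r * E r) / M with hlam
  refine ⟨lam, fun r hr => sub_eq_zero.1 (eqOn_zero_of_integral_test
    (E := fun r => E r - lam * m r) (hE.sub (continuousOn_const.mul hm)) (fun φ hφ => ?_) r hr)⟩
  have hsplit : ∀ G : ℝ → ℝ, ContinuousOn G (Ioo 0 r₀) → ∀ a : ℝ,
      ∫ r in Ioo 0 r₀, (φ r - a * χ r) * G r =
        (∫ r in Ioo 0 r₀, φ r * G r) - a * ∫ r in Ioo 0 r₀, χ r * G r := fun G hG a => by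
    rw [← integral_const_mul, ← integral_sub (hφ.integrableOn_mul hr₀ hG)
      ((hχ.integrableOn_mul hr₀ hG).const_mul a)]
    congr 1
    ext r
    ring
  have key := h _ (hφ.sub_const_mul hχ ((∫ r in Ioo 0 r₀, φ r * m r) / M)) (by
    rw [hsplit m hm, ← hM, div_mul_cancel₀ _ hne, sub_self])
  rw [hsplit E hE] at key
  have e : ∫ r in Ioo 0 r₀, φ r * (E r - lam * m r) =
      (∫ r in Ioo 0 r₀, φ r * E r) - lam * ∫ r in Ioo 0 r₀, φ r * m r := by
    rw [← integral_const_mul, ← integral_sub (hφ.integrableOn_mul hr₀ hE)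
      ((hφ.integrableOn_mul hr₀ hm).const_mul lam)]
    congr 1
    ext r
    ring
  rw [e, hlam]
  linear_combination key

theorem isCritical_iff (hr₀ : 0 < r₀) (hk : 3 ≤ k) (hf : ContDiffOn ℝ (k + 1) f (Ico 0 r₀)) :
    IsCritical k r₀ f ↔ ∀ r ∈ Ioo 0 r₀, gvEuler r₀ f r = 0 := by
  have hf4 := contDiffOn_four hk hf
  refine ⟨fun h => eqOn_zero_of_integral_test ((continuousOn_gvEuler hf4).mono Ioo_subset_Ico_self) fun φ hφ => ?_,
    fun h V hV => ?_⟩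
  · have h1 := (h _ (testVariation_admissible hr₀ hf hφ hk)).unique
      (testVariation_hasDerivAt_gv hr₀ hf hφ hk)
    have hpi := Real.pi_pos
    have h2 : (0 : ℝ) ≠ 2 * (2 * Real.pi) ^ 2 := by positivity
    refine (mul_eq_zero.1 (?_ : 2 * (2 * Real.pi) ^ 2 * _ = 0)).resolve_left h2.symm
    linarith
  · have e : ∀ c, EqOn (fun x => V.ωDot c x eθ * gvEuler r₀ f x.1) 0 (cell r₀) := fun c x hx => by
      simp [h x.1 (cell_subset_region r₀ hx)]
    refine (Variation.hasDerivAt_gv_reeb hr₀ hk hf4 hV fun c => ?_).congr_deriv ?_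
    · exact integrableOn_zero.congr_fun (e c).symm (measurableSet_cell r₀)
    · refine Finset.sum_eq_zero fun c _ => ?_
      rw [setIntegral_congr_fun (measurableSet_cell r₀) (e c)]
      simp

theorem isConstrainedCritical_iff (hr₀ : 0 < r₀) (hk : 3 ≤ k)
    (hf : ContDiffOn ℝ (k + 1) f (Ico 0 r₀)) :
    IsConstrainedCritical k r₀ f ↔
      ∃ lam : ℝ, ∀ r ∈ Ioo 0 r₀, gvEuler r₀ f r = lam * intEuler r₀ f r := by
  have hf4 := contDiffOn_four hk hf
  refine ⟨fun h => exists_multiplier hr₀ ((continuousOn_gvEuler hf4).mono Ioo_subset_Ico_self)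
    ((continuousOn_intEuler hf4).mono Ioo_subset_Ico_self) fun φ hφ horth => ?_,
    fun ⟨lam, h⟩ V hV hV' => Variation.hasDerivAt_gv_of_constrained hr₀ hk hf4 hV hV' h⟩
  have h1 := (h _ (testVariation_admissible hr₀ hf hφ hk)
    (testVariation_constrained hr₀ hf hφ hk horth)).unique
    (testVariation_hasDerivAt_gv hr₀ hf hφ hk)
  have hpi := Real.pi_pos
  have h2 : (0 : ℝ) ≠ 2 * (2 * Real.pi) ^ 2 := by positivity
  refine (mul_eq_zero.1 (?_ : 2 * (2 * Real.pi) ^ 2 * _ = 0)).resolve_left h2.symm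
  linarith

end
/-! ### The Cauchy problems -/

section

variable {r₀ : ℝ} {f : ℝ → ℝ} {r : ℝ}

theorem eq_left_of_hasDerivAt_zero {g : ℝ → ℝ} {a b : ℝ} (hg : ContinuousOn g (Ico a b))
    (hd : ∀ r ∈ Ioo a b, HasDerivAt g 0 r) : ∀ r ∈ Ico a b, g r = g a := fun r hr => by
  have ha : a ∈ Ico a b := ⟨le_rfl, hr.1.trans_lt hr.2⟩
  have hdiff : DifferentiableOn ℝ g (interior (Ico a b)) := fun x hx => by
    rw [interior_Ico] at hx
    exact (hd x hx).differentiableAt.differentiableWithinAt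
  have h0 : ∀ x ∈ interior (Ico a b), deriv g x = 0 := fun x hx => by
    rw [interior_Ico] at hx
    exact (hd x hx).deriv
  exact le_antisymm
    (antitoneOn_of_deriv_nonpos (convex_Ico a b) hg hdiff (fun x hx => (h0 x hx).le) ha hr hr.1)
    (monotoneOn_of_deriv_nonneg (convex_Ico a b) hg hdiff (fun x hx => (h0 x hx).ge) ha hr hr.1)

/-- Equality on `(0, r₀)` extends to `0`. -/
theorem eqOn_Ico_of_eqOn_Ioo (hr₀ : 0 < r₀) {g g' : ℝ → ℝ} (hg : ContinuousOn g (Ico 0 r₀))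
    (hg' : ContinuousOn g' (Ico 0 r₀)) (h : EqOn g g' (Ioo 0 r₀)) : EqOn g g' (Ico 0 r₀) :=
  h.of_subset_closure hg hg' Ioo_subset_Ico_self (by
    rw [closure_Ioo hr₀.ne]
    exact Ico_subset_Icc_self)

theorem sin_reebAngle (r₀ : ℝ) (f : ℝ → ℝ) (r : ℝ) :
    Real.sin (reebAngle r₀ f r) = der r₀ f 1 r / Real.sqrt (1 + der r₀ f 1 r ^ 2) := by
  rw [reebAngle_eq, Real.sin_arctan]

theorem cos_reebAngle (r₀ : ℝ) (f : ℝ → ℝ) (r : ℝ) :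
    Real.cos (reebAngle r₀ f r) = 1 / Real.sqrt (1 + der r₀ f 1 r ^ 2) := by
  rw [reebAngle_eq, Real.cos_arctan]

theorem sin_reebAngle_ne_zero (h : der r₀ f 1 r ≠ 0) : Real.sin (reebAngle r₀ f r) ≠ 0 := by
  rw [sin_reebAngle]
  exact div_ne_zero h (Real.sqrt_pos.2 (by positivity)).ne'

theorem rpow_five_half {a : ℝ} (ha : 0 ≤ a) : a ^ (5 / 2 : ℝ) = Real.sqrt a ^ 5 := by
  rw [Real.sqrt_eq_rpow, ← Real.rpow_natCast, ← Real.rpow_mul ha]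
  norm_num

/-- The third order equation says that the first integral `h' sin μ` takes the value `A₀`. -/
theorem gvMomentum_eq_iff (h : der r₀ f 1 r ≠ 0) (A₀ : ℝ) : gvMomentum r₀ f r = A₀ ↔
    der r₀ f 3 r =
      2 * (der r₀ f 1 r ^ 2 - 1) / ((1 + der r₀ f 1 r ^ 2) * der r₀ f 1 r) * der r₀ f 2 r ^ 2
        + A₀ * (1 + der r₀ f 1 r ^ 2) ^ (5 / 2 : ℝ) / der r₀ f 1 r ^ 3 := by
  rw [gvMomentum, gvCoeffDeriv, sin_reebAngle, rpow_five_half (by positivity)]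
  generalize der r₀ f 1 r = u at *
  generalize der r₀ f 2 r = v
  generalize der r₀ f 3 r = w
  have hs : Real.sqrt (1 + u ^ 2) ^ 2 = 1 + u ^ 2 := Real.sq_sqrt (by positivity)
  have hs0 : Real.sqrt (1 + u ^ 2) ≠ 0 := (Real.sqrt_pos.2 (by positivity)).ne'
  generalize Real.sqrt (1 + u ^ 2) = s at *
  rw [← hs]
  have e : (w * u ^ 2 / (s ^ 2) ^ 2 + 2 * u * v ^ 2 * (1 - u ^ 2) / (s ^ 2) ^ 3) * (u / s) - A₀ =
      (w - (2 * (u ^ 2 - 1) / (s ^ 2 * u) * v ^ 2 + A₀ * s ^ 5 / u ^ 3)) * (u ^ 3 / s ^ 5) := by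
    field_simp
    ring
  have hne : u ^ 3 / s ^ 5 ≠ 0 := by positivity
  rw [← sub_eq_zero, e, mul_eq_zero, or_iff_left hne, sub_eq_zero]

/-- The fourth order equation is the Euler–Lagrange equation where `f' ≠ 0`. -/
theorem gvEuler_eq_iff (h : der r₀ f 1 r ≠ 0) (lam : ℝ) :
    gvEuler r₀ f r = lam * intEuler r₀ f r ↔
    der r₀ f 4 r =
      (6 * der r₀ f 1 r ^ 2 - 7) / (der r₀ f 1 r * (1 + der r₀ f 1 r ^ 2))
          * der r₀ f 3 r * der r₀ f 2 r
        - 2 * (3 * der r₀ f 1 r ^ 4 - 9 * der r₀ f 1 r ^ 2 + 2)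
            / ((1 + der r₀ f 1 r ^ 2) ^ 2 * der r₀ f 1 r ^ 2) * der r₀ f 2 r ^ 3
        + lam * ((1 + der r₀ f 1 r ^ 2) / der r₀ f 1 r ^ 2) * der r₀ f 2 r := by
  rw [gvEuler, intEuler, gvCoeffDeriv₂, gvCoeffDeriv, angleDeriv, sin_reebAngle, cos_reebAngle]
  generalize der r₀ f 1 r = u at *
  generalize der r₀ f 2 r = v
  generalize der r₀ f 3 r = w
  generalize der r₀ f 4 r = z
  have hs0 : Real.sqrt (1 + u ^ 2) ≠ 0 := (Real.sqrt_pos.2 (by positivity)).ne'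
  generalize Real.sqrt (1 + u ^ 2) = s at *
  have hp : 1 + u ^ 2 ≠ 0 := by positivity
  have hne : u ^ 3 / ((1 + u ^ 2) ^ 2 * s) ≠ 0 := by positivity
  rw [← sub_eq_zero, ← sub_eq_zero (a := z), ← or_iff_left (a := z - _ = 0) hne, ← mul_eq_zero]
  refine Eq.congr ?_ rfl
  field_simp
  ring

theorem gvEuler_eq_of_der_eq_zero (h : der r₀ f 1 r = 0) (lam : ℝ) :
    gvEuler r₀ f r = lam * intEuler r₀ f r := by
  have hs : Real.sin (reebAngle r₀ f r) = 0 := by rw [sin_reebAngle, h, zero_div]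
  simp [gvEuler, intEuler, gvCoeffDeriv, hs, h]

theorem derivWithin_eq_der (r₀ : ℝ) (f : ℝ → ℝ) : derivWithin f (Ico 0 r₀) = der r₀ f 1 := by
  ext r
  rw [der, iteratedDerivWithin_one]

/-- If the first integral `h' sin μ` is constant, `f'` has no zero: at a zero the constant is `0`,
and then `h'`, `h` and `f''` vanish after the last zero of `f'`, so that `f'` cannot tend to `∞`. -/
theorem der_one_ne_zero (hf : ContDiffOn ℝ 4 f (Ico 0 r₀))
    (hasymp' : Tendsto (der r₀ f 1) (𝓝[<] r₀) atTop) {A : ℝ}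
    (hA : ∀ r ∈ Ico 0 r₀, gvMomentum r₀ f r = A) : ∀ r ∈ Ico 0 r₀, der r₀ f 1 r ≠ 0 := by
  intro r₁ hr₁ hz
  have hr₀ : 0 < r₀ := hr₁.1.trans_lt hr₁.2
  have hsin : ∀ r, der r₀ f 1 r = 0 → Real.sin (reebAngle r₀ f r) = 0 := fun r h => by
    rw [sin_reebAngle, h, zero_div]
  have hA0 : A = 0 := by rw [← hA r₁ hr₁, gvMomentum, hsin r₁ hz, mul_zero]
  have hpos : ∀ᶠ r in 𝓝[<] r₀, 0 < der r₀ f 1 r := hasymp'.eventually_gt_atTop 0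
  obtain ⟨b, hb, hbpos⟩ := (mem_nhdsLT_iff_exists_Ioo_subset' hr₀).1 hpos
  have hbr : b < r₀ := hb
  have hsub : Icc 0 b ⊆ Ico 0 r₀ := fun r hr => ⟨hr.1, hr.2.trans_lt hbr⟩
  have hle : ∀ r ∈ Ico 0 r₀, der r₀ f 1 r = 0 → r ≤ b := fun r hr h0 => by
    by_contra hlt
    have h1 : 0 < der r₀ f 1 r := hbpos ⟨not_le.1 hlt, hr.2⟩
    exact h1.ne' h0
  have hK : IsCompact (Icc 0 b ∩ der r₀ f 1 ⁻¹' {0}) :=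
    isCompact_Icc.of_isClosed_subset
      (((continuousOn_der hf (by norm_num)).mono hsub).preimage_isClosed_of_isClosed isClosed_Icc
        isClosed_singleton) inter_subset_left
  obtain ⟨a, ha, hmax⟩ := hK.exists_isGreatest ⟨r₁, ⟨hr₁.1, hle r₁ hr₁ hz⟩, hz⟩
  have ha0 : der r₀ f 1 a = 0 := ha.2
  have har : a < r₀ := (hsub ha.1).2
  have hsub' : Ico a r₀ ⊆ Ico 0 r₀ := fun r hr => ⟨ha.1.1.trans hr.1, hr.2⟩
  have hIoo : ∀ r ∈ Ioo a r₀, r ∈ Ioo 0 r₀ := fun r hr => ⟨ha.1.1.trans_lt hr.1, hr.2⟩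
  have hne : ∀ r ∈ Ioo a r₀, der r₀ f 1 r ≠ 0 := fun r hr h0 => by
    have hr' := hsub' ⟨hr.1.le, hr.2⟩
    exact absurd (hmax ⟨⟨hr'.1, hle r hr' h0⟩, h0⟩) (not_le.2 hr.1)
  have hh' : ∀ r ∈ Ioo a r₀, gvCoeffDeriv r₀ f r = 0 := fun r hr => by
    have h := hA r (hsub' ⟨hr.1.le, hr.2⟩)
    rw [hA0, gvMomentum] at h
    exact (mul_eq_zero.1 h).resolve_right (sin_reebAngle_ne_zero (hne r hr))
  have hh : ∀ r ∈ Ico a r₀, gvCoeff r₀ f r = 0 := fun r hr => by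
    rw [eq_left_of_hasDerivAt_zero ((continuousOn_gvCoeff hf).mono hsub')
      (fun r hr => hh' r hr ▸ hasDerivAt_gvCoeff hf (hIoo r hr)) r hr, gvCoeff, hsin a ha0]
    simp
  have hder2 : ∀ r ∈ Ioo a r₀, der r₀ f 2 r = 0 := fun r hr => by
    have h := hh r ⟨hr.1.le, hr.2⟩
    rw [gvCoeff, mul_eq_zero, or_iff_left (pow_ne_zero 2 (sin_reebAngle_ne_zero (hne r hr))),
      angleDeriv, div_eq_zero_iff] at h
    exact h.resolve_right (by positivity)
  obtain ⟨c, hac, hcr⟩ := exists_between har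
  refine hne c ⟨hac, hcr⟩ ?_
  rw [eq_left_of_hasDerivAt_zero (g := der r₀ f 1)
    ((continuousOn_der hf (by norm_num)).mono hsub')
    (fun r hr => hder2 r hr ▸ hasDerivAt_der hf (by norm_num) (hIoo r hr)) c ⟨hac.le, hcr⟩, ha0]

theorem gvEuler_eq_zero_iff (hr₀ : 0 < r₀) (hf : ContDiffOn ℝ 4 f (Ico 0 r₀)) (hf0 : f 0 = 0)
    (hasymp' : Tendsto (der r₀ f 1) (𝓝[<] r₀) atTop) :
    (∀ r ∈ Ioo 0 r₀, gvEuler r₀ f r = 0) ↔ ∃ A₀ A₁ A₂ : ℝ, SolvesThirdOrder r₀ f A₀ A₁ A₂ := by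
  have h0 : (0 : ℝ) ∈ Ico 0 r₀ := ⟨le_rfl, hr₀⟩
  constructor
  · intro h
    have hA : ∀ r ∈ Ico 0 r₀, gvMomentum r₀ f r = gvMomentum r₀ f 0 :=
      eq_left_of_hasDerivAt_zero (continuousOn_gvMomentum hf)
        fun r hr => h r hr ▸ hasDerivAt_gvMomentum hf hr
    have hne := der_one_ne_zero hf hasymp' hA
    exact ⟨gvMomentum r₀ f 0, der r₀ f 1 0, der r₀ f 2 0,
      fun r hr => ⟨hne r hr, (gvMomentum_eq_iff (hne r hr) _).1 (hA r hr)⟩, hf0, rfl, hne 0 h0, rfl⟩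
  · rintro ⟨A₀, A₁, A₂, h, -⟩ r hr
    have hc : gvMomentum r₀ f =ᶠ[𝓝 r] fun _ => A₀ := by
      filter_upwards [isOpen_Ioo.mem_nhds hr] with ρ hρ
      have hρ' := h ρ (Ioo_subset_Ico_self hρ)
      exact (gvMomentum_eq_iff hρ'.1 A₀).2 hρ'.2
    exact (hasDerivAt_gvMomentum hf hr).unique
      ((hasDerivAt_const r A₀).congr_of_eventuallyEq hc)

theorem gvEuler_eq_mul_iff (hr₀ : 0 < r₀) (hf : ContDiffOn ℝ 4 f (Ico 0 r₀)) (hf0 : f 0 = 0)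
    (h1 : der r₀ f 1 0 ≠ 0) :
    (∃ lam : ℝ, ∀ r ∈ Ioo 0 r₀, gvEuler r₀ f r = lam * intEuler r₀ f r) ↔
      ∃ lam A₁ A₂ A₃ : ℝ, SolvesFourthOrder r₀ f lam A₁ A₂ A₃ := by
  constructor
  · rintro ⟨lam, h⟩
    have h' : EqOn (gvEuler r₀ f) (fun r => lam * intEuler r₀ f r) (Ico 0 r₀) :=
      eqOn_Ico_of_eqOn_Ioo hr₀ (continuousOn_gvEuler hf)
        (continuousOn_const.mul (continuousOn_intEuler hf)) h
    exact ⟨lam, der r₀ f 1 0, der r₀ f 2 0, der r₀ f 3 0,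
      fun r hr hne => (gvEuler_eq_iff hne lam).1 (h' hr), hf0, rfl, h1, rfl, rfl⟩
  · rintro ⟨lam, A₁, A₂, A₃, h, -⟩
    refine ⟨lam, fun r hr => ?_⟩
    rcases eq_or_ne (der r₀ f 1 r) 0 with hz | hne
    · exact gvEuler_eq_of_der_eq_zero hz lam
    · exact (gvEuler_eq_iff hne lam).2 (h r (Ioo_subset_Ico_self hr) hne)

end
end ReebGV

end

theorem mainTheorem8 (k : ℕ∞) (hk : 3 ≤ k) (r₀ : ℝ) (hr₀ : 0 < r₀) (f : ℝ → ℝ)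
    (hf : ContDiffOn ℝ (k + 1) f (Set.Ico 0 r₀)) (hf0 : f 0 = 0)
    (hasymp : Filter.Tendsto f (nhdsWithin r₀ (Set.Iio r₀)) Filter.atTop)
    (hasymp' : Filter.Tendsto (derivWithin f (Set.Ico 0 r₀)) (nhdsWithin r₀ (Set.Iio r₀))
      Filter.atTop) :
    (ReebGV.IsCritical k r₀ f ↔ ∃ A₀ A₁ A₂ : ℝ, ReebGV.SolvesThirdOrder r₀ f A₀ A₁ A₂) ∧
    (derivWithin f (Set.Ico 0 r₀) 0 ≠ 0 →
      (ReebGV.IsConstrainedCritical k r₀ f ↔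
        ∃ lam A₁ A₂ A₃ : ℝ, ReebGV.SolvesFourthOrder r₀ f lam A₁ A₂ A₃)) := by
  have hf4 := ReebGV.contDiffOn_four hk hf
  rw [ReebGV.derivWithin_eq_der] at hasymp' ⊢
  exact ⟨(ReebGV.isCritical_iff hr₀ hk hf).trans
      (ReebGV.gvEuler_eq_zero_iff hr₀ hf4 hf0 hasymp'),
    fun h1 => (ReebGV.isConstrainedCritical_iff hr₀ hk hf).trans
      (ReebGV.gvEuler_eq_mul_iff hr₀ hf4 hf0 h1)⟩
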